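/- **Conventions.** Filtrations are indexed by the non-positive integers (or, for triples, by $0,1,2$), and all sub-$\sigma$-fields are completed by the null events of the ambient probability space. Random variables are uniform on a finite set $F$ if their law is the uniform probability on $F$. The natural filtration $\mathcal F^X$ of a process $X$ is given by $\mathcal F^X_n=\sigma(X_k : k\le n)$. A filtration $\mathcal F$ is *immersed* into $\mathcal G$ (on the same probability space) if $\mathcal F_n\subset\mathcal G_n$ for every $n$ and, for every $n$ for which the time $n-1$ exists, $\mathcal F_n$ and $\mathcal G_{n-1}$ are independent conditionally on $\mathcal F_{n-1}$. A filtration is *of product type* if it is the natural filtration of a sequence of independent (real) random variables. An *isomorphism* from $(\Omega,\mathbb P,\mathcal F)$ to $(\Omega',\mathbb P',\mathcal F')$ is a bijection $\Psi$ from $L^0(\Omega,\mathcal F_\infty,\mathbb P)$ to $L^0(\Omega',\mathcal F'_\infty,\mathbb P')$ (spaces of real random variables modulo almost sure equality, $\mathcal F_\infty$ being generated by all the $\mathcal F_n$) that preserves laws, commutes with Borel functions $\mathbb R^{\mathbb N}\to\mathbb R$ of sequences of random variables, and is such that, for every $n$, the variables $\Psi(Y)$ with $Y\in L^0(\Omega,\mathcal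 F_n,\mathbb P)$ generate $\mathcal F'_n$. A filtration $\mathcal F$ is *standard* if, on some probability space, there is a filtration $\mathcal F'$ isomorphic to $\mathcal F$ which is immersed into some product-type filtration. A *non-anticipative coupling* of two copies of a process $Z$ is a pair of processes $Z',Z''$, defined on one probability space $(\bar\Omega,\bar{\mathcal A},\bar{\mathbb P})$, each having the law of $Z$, such that the natural filtrations of $Z'$ and of $Z''$ are both immersed into the natural filtration of $(Z',Z'')$. For $\alpha\in\,]0,1[$, a triple $(Z_0,Z_1,Z_2)$ of uniform random variables on finite sets is a *Tsirelson $\alpha$-brick* if it is Markov, if $Z_0$ and $Z_2$ are independent, and if for every non-anticipative coupling $(Z'_0,Z'_1,Z'_2)$, $(Z''_0,Z''_1,Z''_2)$ of two copies of it, $$\bar{\mathbb P}\big[Z'_2\ne Z''_2\,\big|\,\sigma(Z'_0,Z''_0)\big]\ge 1-\alpha\quad\text{almost surely on the event }[Z'_0\ne Z''_0].$$ **Theorem (Tsirelson's construction).** Let $(X_n)_{n\le 0}$ be a sequence of uniform random variables with values in finite sets $(F_n)_{n\le 0}$, defined on one probability space, and let $(\alpha_n)_{n\le 0}$ be a $]0,1[$-valued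 sequence such that $\sum_{n\le0}\alpha_n<+\infty$. Assume that - for every $n\le 0$, the set $F_{2n}$ is not a singleton; - $(X_n)_{n\le 0}$ is a (not necessarily homogeneous) Markov process; - for every $n\le 0$, the triple $(X_{2n-2},X_{2n-1},X_{2n})$ is a Tsirelson $\alpha_n$-brick. Then the natural filtration $\mathcal F^X$ is not standard. Moreover, if the tail $\sigma$-field $\mathcal F^X_{-\infty}=\bigcap_{n\le 0}\mathcal F^X_n$ is trivial (all its events have probability $0$ or $1$), then $|F_{2n}|\to+\infty$ as $n\to-\infty$. -/

import Mathlib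

open MeasureTheory ProbabilityTheory Filter

universe u v w

/-- The time set: the non-positive integers. -/
abbrev NonposInt : Type := {n : ℤ // n ≤ 0}

section SigmaFields

variable {Ω : Type*} {mΩ : MeasurableSpace Ω}

/-- The completion of a sub-σ-field `m`: all events (measurable sets of `Ω`) that agree with
an event of `m` up to a `μ`-null set. -/
@[reducible]
def completion (μ : Measure Ω) (m : MeasurableSpace Ω) : MeasurableSpace Ω :=
  eventuallyMeasurableSpace m (ae μ) ⊓ mΩ

/-- Events of the completion: measurable sets which are a.e. equal to an event of `m`. -/
theorem measurableSet_completion_iff {μ : Measure Ω} {m : MeasurableSpace Ω} {s : Set Ω} :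
    MeasurableSet[completion μ m] s ↔
      (∃ t, MeasurableSet[m] t ∧ s =ᵐ[μ] t) ∧ MeasurableSet[mΩ] s :=
  MeasurableSpace.measurableSet_inf

/-- The completion is monotone. -/
theorem completion_mono (μ : Measure Ω) {m₁ m₂ : MeasurableSpace Ω} (h : m₁ ≤ m₂) :
    completion μ m₁ ≤ completion μ m₂ := by
  intro s hs
  rw [measurableSet_completion_iff] at hs ⊢
  obtain ⟨⟨t, ht, hst⟩, hs'⟩ := hs
  exact ⟨⟨t, h t ht, hst⟩, hs'⟩

/-- `m₁` and `m₂` are independent conditionally on `m` (without any assumption on the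
measurable space `Ω`). -/
def CondIndepSigma (μ : Measure Ω) (m m₁ m₂ : MeasurableSpace Ω) : Prop :=
  ∀ s t : Set Ω, MeasurableSet[m₁] s → MeasurableSet[m₂] t →
    μ⟦s ∩ t | m⟧ =ᵐ[μ] μ⟦s | m⟧ * μ⟦t | m⟧

/-- The σ-field `m` is trivial: all its events have probability `0` or `1`. -/
def IsTrivialSigma (μ : Measure Ω) (m : MeasurableSpace Ω) : Prop :=
  ∀ s : Set Ω, MeasurableSet[m] s → μ s = 0 ∨ μ s = 1

/-- The set `L⁰(Ω, m, μ)` of (classes modulo `μ` of) real random variables that are measurable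
with respect to `m`, up to null sets. -/
def L0 (μ : Measure Ω) : MeasurableSpace Ω → Set (Ω →ₘ[μ] ℝ) :=
  fun m => {f | AEStronglyMeasurable[m] (@AEEqFun.cast Ω ℝ mΩ μ _ f) μ}

end SigmaFields

section Filtrations

variable {ι : Type*} [Preorder ι]

/-- The natural filtration of a process `X`: at time `i`, the complete σ-field generated by
the `X j` with `j ≤ i`. -/
def naturalFiltration {Ω : Type*} {mΩ : MeasurableSpace Ω} (μ : Measure Ω) {E : ι → Type*}
    [∀ i, MeasurableSpace (E i)] (X : (i : ι) → Ω → E i) : Filtration ι mΩ where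
  seq i := completion μ (⨆ j ≤ i, MeasurableSpace.comap (X j) inferInstance)
  mono' _ _ hij := completion_mono μ (biSup_mono fun _ h => h.trans hij)
  le' _ := inf_le_right

/-- `F` is immersed into `G`: for every `j` with immediate predecessor `i`, `F j` and `G i` are
independent conditionally on `F i`, and `F j ⊆ G j` for all `j`. -/
def Immersed {Ω : Type*} {mΩ : MeasurableSpace Ω} (μ : Measure Ω) (F G : Filtration ι mΩ) :
    Prop :=
  (∀ j, F j ≤ G j) ∧ ∀ i j, i ⋖ j → CondIndepSigma μ (F i) (F j) (G i)

/-- An isomorphism of filtered probability spaces from `(Ω, μ, F)` to `(Ω', μ', F')`: a bijection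
from `L⁰(Ω, F_∞, μ)` to `L⁰(Ω', F'_∞, μ')` that preserves the laws, commutes with Borel
operations and sends `F` to `F'`. -/
structure FilteredIso {Ω Ω' : Type*} {mΩ : MeasurableSpace Ω} {mΩ' : MeasurableSpace Ω'}
    (μ : Measure Ω) (F : Filtration ι mΩ) (μ' : Measure Ω') (F' : Filtration ι mΩ') where
  /-- the bijection -/
  toEquiv : L0 μ (⨆ i, F i) ≃ L0 μ' (⨆ i, F' i)
  law_eq : ∀ Y, μ'.map ((toEquiv Y : Ω' →ₘ[μ'] ℝ) : Ω' → ℝ) = μ.map ((Y : Ω →ₘ[μ] ℝ) : Ω → ℝ)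
  comm_borel : ∀ (Y : ℕ → L0 μ (⨆ i, F i)) (Φ : (ℕ → ℝ) → ℝ), Measurable Φ →
    ∀ Z : L0 μ (⨆ i, F i),
      ((Z : Ω →ₘ[μ] ℝ) : Ω → ℝ) =ᵐ[μ] (fun ω => Φ fun k => (Y k : Ω →ₘ[μ] ℝ) ω) →
      ((toEquiv Z : Ω' →ₘ[μ'] ℝ) : Ω' → ℝ) =ᵐ[μ']
        (fun ω => Φ fun k => (toEquiv (Y k) : Ω' →ₘ[μ'] ℝ) ω)
  /-- For each `i`, the images of the `F i`-measurable random variables generate `F' i`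
  (as complete σ-fields). -/
  generate : ∀ i, completion μ' (⨆ (Y : L0 μ (⨆ i, F i)) (_ : (Y : Ω →ₘ[μ] ℝ) ∈ L0 μ (F i)),
      MeasurableSpace.comap ((toEquiv Y : Ω' →ₘ[μ'] ℝ) : Ω' → ℝ) inferInstance) = completion μ' (F' i)

/-- A filtration is of product type if it is the natural filtration of a family of independent
real random variables. -/
def IsProductType {Ω : Type*} {mΩ : MeasurableSpace Ω} (μ : Measure Ω) (G : Filtration ι mΩ) :
    Prop :=
  ∃ V : ι → Ω → ℝ, (∀ i, Measurable (V i)) ∧ iIndepFun V μ ∧ G = naturalFiltration μ V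

/-- A filtration `F` is standard if it is immersible into a product-type filtration: on some
probability space there are a product-type filtration `G'` and a filtration `F'` isomorphic
to `F` which is immersed into `G'`. The second universe is the one of the new space. -/
def IsStandard {Ω : Type u} {mΩ : MeasurableSpace Ω} (μ : Measure Ω) (F : Filtration ι mΩ) :
    Prop :=
  ∃ (Ω' : Type v) (mΩ' : MeasurableSpace Ω') (μ' : Measure Ω') (F' G' : Filtration ι mΩ'),
    IsProbabilityMeasure μ' ∧ Nonempty (FilteredIso μ F μ' F') ∧ IsProductType μ' G' ∧
      Immersed μ' F' G'

/-- `X` is a (not necessarily homogeneous) Markov process: for every `j` with immediate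
predecessor `i`, the conditional law of `X j` given the past up to `i` is its conditional law
given `X i`. -/
def IsMarkov {Ω : Type*} {mΩ : MeasurableSpace Ω} (μ : Measure Ω) {E : ι → Type*}
    [∀ i, MeasurableSpace (E i)] (X : (i : ι) → Ω → E i) : Prop :=
  ∀ i j, i ⋖ j → ∀ s : Set (E j), MeasurableSet s →
    μ⟦X j ⁻¹' s | naturalFiltration μ X i⟧ =ᵐ[μ]
      μ⟦X j ⁻¹' s | MeasurableSpace.comap (X i) inferInstance⟧

/-- The processes `X'` and `X''`, defined on the same probability space `(Ω', P)`, form a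
non-anticipative coupling of two copies of the process `X`: both have the law of `X`, and their
natural filtrations are immersed into the natural filtration of `(X', X'')`. -/
structure IsNonAnticipativeCoupling {Ω Ω' : Type*} {mΩ : MeasurableSpace Ω}
    {mΩ' : MeasurableSpace Ω'} (μ : Measure Ω) {E : ι → Type*} [∀ i, MeasurableSpace (E i)]
    (X : (i : ι) → Ω → E i) (P : Measure Ω') (X' X'' : (i : ι) → Ω' → E i) : Prop where
  measurable_left : ∀ i, Measurable (X' i)
  measurable_right : ∀ i, Measurable (X'' i)
  law_left : P.map (fun ω i => X' i ω) = μ.map (fun ω i => X i ω)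
  law_right : P.map (fun ω i => X'' i ω) = μ.map (fun ω i => X i ω)
  immersed_left : Immersed P (naturalFiltration P X')
    (naturalFiltration P fun i ω => (X' i ω, X'' i ω))
  immersed_right : Immersed P (naturalFiltration P X'')
    (naturalFiltration P fun i ω => (X' i ω, X'' i ω))

end Filtrations

/-- `X` is a random variable which is uniformly distributed on the finite set `E`. -/
def IsUniformRV {Ω : Type*} {mΩ : MeasurableSpace Ω} (μ : Measure Ω) {E : Type*}
    [MeasurableSpace E] (X : Ω → E) : Prop :=
  Measurable X ∧ μ.map X = uniformOn Set.univ

/-- A triple `Z = (Z 0, Z 1, Z 2)` of uniform random variables with values in the finite sets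
`E 0`, `E 1`, `E 2` is a Tsirelson `α`-brick. (As the variables take finitely many values, it
makes no difference in which universe the spaces carrying the couplings live.) -/
structure IsTsirelsonBrick {Ω : Type*} {mΩ : MeasurableSpace Ω} (μ : Measure Ω)
    {E : Fin 3 → Type*} [∀ k, Fintype (E k)] [∀ k, MeasurableSpace (E k)] (α : ℝ)
    (Z : (k : Fin 3) → Ω → E k) : Prop where
  uniform : ∀ k, IsUniformRV μ (Z k)
  markov : IsMarkov μ Z
  indep : IndepFun (Z 0) (Z 2) μ
  coupling : ∀ (Ω' : Type) (_ : MeasurableSpace Ω') (P : Measure Ω'), IsProbabilityMeasure P →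
    ∀ Z' Z'' : (k : Fin 3) → Ω' → E k, IsNonAnticipativeCoupling μ Z P Z' Z'' →
      ∀ᵐ ω ∂P, Z' 0 ω ≠ Z'' 0 ω →
        1 - α ≤ (P⟦{ω' | Z' 2 ω' ≠ Z'' 2 ω'} |
          MeasurableSpace.comap (fun ω' => (Z' 0 ω', Z'' 0 ω')) inferInstance⟧) ω

/-- The time `2n`, for `n ≤ 0`. -/
def NonposInt.double (n : NonposInt) : NonposInt := ⟨2 * n.1, by have := n.2; omega⟩

/-- The times `2n - 2`, `2n - 1`, `2n` (for `k = 0, 1, 2`), for `n ≤ 0`. -/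
def NonposInt.brickTime (n : NonposInt) (k : Fin 3) : NonposInt :=
  ⟨2 * n.1 - 2 + (k : ℕ), by have := n.2; have := k.2; omega⟩

/-!
Suppose that the filtration is standard. Carrying `X` along the isomorphism and through the
immersion, and then to the law of the independent sequence, we may take `X` to be a process on a
product of real lines, Markov with respect to the filtration of the coordinates. Resampling the
coordinates up to time `m` yields a second copy of `X`; the two copies form a non-anticipative
coupling, their pasts up to `m` are independent, and at a fixed time they agree with probability
tending to `1` as `m → -∞` (cosiness). Bricks forbid this: in any non-anticipative coupling
`P(X'₂ₙ ≠ X''₂ₙ) ≥ (1 - αₙ) P(X'₂ₙ₋₂ ≠ X''₂ₙ₋₂)`, so this probability, which is at least `1/2` at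
a remote even time `m` because `X'ₘ` and `X''ₘ` are independent and uniform, later decreases by at
most a tail of `∑ αₙ`.

For the cardinalities, couple two copies of a brick independently. As `X₂ₙ₋₂` and `X₂ₙ` are
independent, the brick inequality becomes `1 - 1 / |F₂ₙ| ≥ 1 - αₙ`, and `αₙ → 0`.
-/

open scoped NNReal ENNReal Topology

section ConditionalProbability

variable {Ω Ω' : Type*} {F F' G H mΩ : MeasurableSpace Ω} {H' mΩ' : MeasurableSpace Ω'}
  {P : Measure Ω} {P' : Measure Ω'} {s u : Set Ω} {p : ℝ≥0}

/-- On the event `s`, the conditional probability of `u` given the σ-field `H` is the constant `p`.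
The defining identity makes no reference to `P⟦u | H⟧`, so that it can be moved along maps. -/
def HasCondProb {_mΩ : MeasurableSpace Ω} (P : Measure Ω) (H : MeasurableSpace Ω)
    (s u : Set Ω) (p : ℝ≥0) : Prop :=
  ∀ t, MeasurableSet[H] t → P (t ∩ s ∩ u) = p * P (t ∩ s)

namespace HasCondProb

theorem mono (h : HasCondProb P H s u p) (hF : F ≤ H) : HasCondProb P F s u p :=
  fun t ht => h t (hF t ht)

theorem congr {s' u' : Set Ω} (h : HasCondProb P H s u p) (hs : s =ᵐ[P] s') (hu : u =ᵐ[P] u') :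
    HasCondProb P H s' u' p := by
  intro t ht
  have hts : (t ∩ s : Set Ω) =ᵐ[P] (t ∩ s' : Set Ω) := (ae_eq_refl t).inter hs
  rw [← measure_congr hts, ← measure_congr (hts.inter hu)]
  exact h t ht

theorem completion (h : HasCondProb P H s u p) : HasCondProb P (completion P H) s u p := by
  intro t ht
  obtain ⟨⟨t', ht', htt'⟩, -⟩ := measurableSet_completion_iff.1 ht
  have hts : (t ∩ s : Set Ω) =ᵐ[P] (t' ∩ s : Set Ω) := htt'.inter (ae_eq_refl s)
  rw [measure_congr hts, measure_congr (hts.inter (ae_eq_refl u))]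
  exact h t' ht'

theorem prod_fst [SFinite P] [SFinite P'] (h : HasCondProb P H s u p) (hH : H ≤ mΩ)
    (hH' : H' ≤ mΩ') (hs : MeasurableSet s) (hu : MeasurableSet u) :
    HasCondProb (P.prod P') (H.prod H') (Prod.fst ⁻¹' s) (Prod.fst ⁻¹' u) p := by
  intro t ht
  have ht' : MeasurableSet t :=
    sup_le_sup (MeasurableSpace.comap_mono hH) (MeasurableSpace.comap_mono hH') t ht
  have hts := ht'.inter (measurable_fst hs)
  rw [Measure.prod_apply_symm hts, Measure.prod_apply_symm (hts.inter (measurable_fst hu)),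
    ← lintegral_const_mul _ (measurable_measure_prodMk_right hts)]
  exact lintegral_congr fun y => h _ (measurable_prodMk_right ht)

theorem prod_snd [SFinite P'] {s u : Set Ω'} (h : HasCondProb P' H' s u p)
    (hH : H ≤ mΩ) (hH' : H' ≤ mΩ') (hs : MeasurableSet s) (hu : MeasurableSet u) :
    HasCondProb (P.prod P') (H.prod H') (Prod.snd ⁻¹' s) (Prod.snd ⁻¹' u) p := by
  intro t ht
  have ht' : MeasurableSet t :=
    sup_le_sup (MeasurableSpace.comap_mono hH) (MeasurableSpace.comap_mono hH') t ht
  have hts := ht'.inter (measurable_snd hs)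
  rw [Measure.prod_apply hts, Measure.prod_apply (hts.inter (measurable_snd hu)),
    ← lintegral_const_mul _ (measurable_measure_prodMk_left hts)]
  exact lintegral_congr fun x => h _ (measurable_prodMk_left ht)

theorem condExp_eq [IsFiniteMeasure P] (h : HasCondProb P H s u p) (hH : H ≤ mΩ)
    (hs : MeasurableSet[H] s) (hu : MeasurableSet u) :
    ∀ᵐ ω ∂P, ω ∈ s → (P⟦u | H⟧) ω = p := by
  have hint : Integrable (u.indicator fun _ => (1 : ℝ)) P := (integrable_const 1).indicator hu
  have hconst : s.indicator (fun _ => (p : ℝ)) =ᵐ[P]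
      P[s.indicator (u.indicator fun _ => (1 : ℝ)) | H] := by
    refine ae_eq_condExp_of_forall_setIntegral_eq hH (hint.indicator (hH s hs))
      (fun _ _ _ => ((integrable_const _).indicator (hH s hs)).integrableOn) (fun t ht _ => ?_)
      (stronglyMeasurable_const.indicator hs).aestronglyMeasurable
    rw [Set.indicator_indicator, setIntegral_indicator (hH s hs),
      setIntegral_indicator ((hH s hs).inter hu), ← Set.inter_assoc]
    simp [Measure.real, h t ht, mul_comm]
  filter_upwards [hconst.trans (condExp_indicator hint hs)] with ω hω hωs
  simpa [hωs] using hω.symm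

end HasCondProb

theorem hasCondProb_map_iff {φ : Ω → Ω'} (hφ : Measurable φ) {s u : Set Ω'} (hH' : H' ≤ mΩ')
    (hs : MeasurableSet s) (hu : MeasurableSet u) :
    HasCondProb (P.map φ) H' s u p ↔ HasCondProb P (H'.comap φ) (φ ⁻¹' s) (φ ⁻¹' u) p := by
  have key : ∀ t, MeasurableSet[H'] t →
      ((P.map φ) (t ∩ s ∩ u) = p * (P.map φ) (t ∩ s) ↔
        P (φ ⁻¹' t ∩ φ ⁻¹' s ∩ φ ⁻¹' u) = p * P (φ ⁻¹' t ∩ φ ⁻¹' s)) := fun t ht => by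
    have hts := (hH' t ht).inter hs
    rw [Measure.map_apply hφ hts, Measure.map_apply hφ (hts.inter hu), Set.preimage_inter,
      Set.preimage_inter]
  constructor
  · rintro h _ ⟨t, ht, rfl⟩
    exact (key t ht).1 (h t ht)
  · exact fun h t ht => (key t ht).2 (h _ ⟨t, ht, rfl⟩)

theorem comap_biSup_eval {T : Type*} {E : T → Type*} [∀ i, MeasurableSpace (E i)] (S : Set T)
    (X : (i : T) → Ω → E i) :
    (⨆ i ∈ S, MeasurableSpace.comap (fun x : (i : T) → E i => x i) inferInstance).comap
      (fun ω i => X i ω) = ⨆ i ∈ S, MeasurableSpace.comap (X i) inferInstance := by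
  simp only [MeasurableSpace.comap_iSup, MeasurableSpace.comap_comp, Function.comp_def]

theorem HasCondProb.of_map_eq {T : Type*} {E : T → Type*} [∀ i, MeasurableSpace (E i)] {S : Set T}
    {X : (i : T) → Ω → E i} {X' : (i : T) → Ω' → E i} {i j : T} {s : Set (E i)} {u : Set (E j)}
    (h : HasCondProb P (⨆ k ∈ S, MeasurableSpace.comap (X k) inferInstance)
      (X i ⁻¹' s) (X j ⁻¹' u) p) (hX : ∀ k, Measurable (X k)) (hX' : ∀ k, Measurable (X' k))
    (hlaw : P.map (fun ω k => X k ω) = P'.map fun ω k => X' k ω) (hs : MeasurableSet s)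
    (hu : MeasurableSet u) :
    HasCondProb P' (⨆ k ∈ S, MeasurableSpace.comap (X' k) inferInstance)
      (X' i ⁻¹' s) (X' j ⁻¹' u) p := by
  have hle : (⨆ k ∈ S, MeasurableSpace.comap (fun x : (k : T) → E k => x k) inferInstance) ≤
      MeasurableSpace.pi := iSup₂_le fun k _ => (measurable_pi_apply k).comap_le
  have hs' := measurable_pi_apply (X := E) i hs
  have hu' := measurable_pi_apply (X := E) j hu
  rw [← comap_biSup_eval S X] at h
  have hπ := (hasCondProb_map_iff (measurable_pi_lambda _ hX) hle hs' hu').2 h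
  rw [hlaw, hasCondProb_map_iff (measurable_pi_lambda _ hX') hle hs' hu', comap_biSup_eval] at hπ
  exact hπ

theorem hasCondProb_iff_measureReal [IsFiniteMeasure P] :
    HasCondProb P H s u p ↔
      ∀ t, MeasurableSet[H] t → P.real (t ∩ s ∩ u) = p * P.real (t ∩ s) := by
  refine forall₂_congr fun t _ => ?_
  rw [← ENNReal.toReal_eq_toReal_iff' (by finiteness) (by finiteness), ENNReal.toReal_mul]
  rfl

theorem setIntegral_condProb [IsFiniteMeasure P] (hH : H ≤ mΩ) (hs : MeasurableSet[H] s)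
    (hu : MeasurableSet u) : ∫ ω in s, (P⟦u | H⟧) ω ∂P = P.real (s ∩ u) := by
  rw [setIntegral_condExp hH ((integrable_const (1 : ℝ)).indicator hu) hs, setIntegral_indicator hu]
  simp

theorem CondIndepSigma.hasCondProb [IsFiniteMeasure P] (hci : CondIndepSigma P F F' G)
    (hF : F ≤ mΩ) (hF' : F' ≤ mΩ) (hG : G ≤ mΩ) (hs : MeasurableSet[F] s)
    (hu : MeasurableSet[F'] u) (h : HasCondProb P F s u p) : HasCondProb P G s u p := by
  refine hasCondProb_iff_measureReal.2 fun t ht => ?_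
  calc P.real (t ∩ s ∩ u) = P.real (s ∩ (u ∩ t)) := by
        rw [Set.inter_comm u t, ← Set.inter_assoc, Set.inter_comm s t]
    _ = ∫ ω in s, (P⟦u ∩ t | F⟧) ω ∂P :=
        (setIntegral_condProb hF hs ((hF' u hu).inter (hG t ht))).symm
    _ = ∫ ω in s, p * (P⟦t | F⟧) ω ∂P := by
        refine setIntegral_congr_ae (hF s hs) ?_
        filter_upwards [hci u t hu ht, h.condExp_eq hF hs (hF' u hu)] with ω hω hp hωs
        rw [hω, Pi.mul_apply, hp hωs]
    _ = p * P.real (t ∩ s) := by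
        rw [integral_const_mul, setIntegral_condProb hF hs (hG t ht), Set.inter_comm]

end ConditionalProbability

section Markov

variable {Ω Ω' ι κ : Type*} [Preorder ι] [Preorder κ] {mΩ : MeasurableSpace Ω}
  {mΩ' : MeasurableSpace Ω'} {P : Measure Ω} {P' : Measure Ω'}
  {E : ι → Type*} [∀ i, MeasurableSpace (E i)] {X : (i : ι) → Ω → E i}

theorem le_completion {m : MeasurableSpace Ω} (hm : m ≤ mΩ) : m ≤ completion P m :=
  le_inf (fun s hs => ⟨s, hs, ae_eq_refl s⟩) hm

theorem iSup_comap_le_of_measurable {m : MeasurableSpace Ω} {i : ι}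
    (hX : ∀ j ≤ i, Measurable[m] (X j)) :
    (⨆ j ≤ i, MeasurableSpace.comap (X j) inferInstance) ≤ m :=
  iSup₂_le fun j hj => (hX j hj).comap_le

theorem measurable_naturalFiltration (hX : ∀ i, Measurable (X i)) {i j : ι} (hij : i ≤ j) :
    Measurable[naturalFiltration P X j] (X i) :=
  measurable_iff_comap_le.2 <| (le_iSup₂_of_le i hij le_rfl).trans <|
    le_completion <| iSup_comap_le_of_measurable fun j _ => hX j

theorem naturalFiltration_comp_le {B : ι → Type*} [∀ i, MeasurableSpace (B i)]
    {φ : (i : ι) → E i → B i} (hφ : ∀ i, Measurable (φ i)) (i : ι) :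
    naturalFiltration P (fun i ω => φ i (X i ω)) i ≤ naturalFiltration P X i :=
  completion_mono P <| iSup₂_mono fun j _ => ((hφ j).comp (comap_measurable (X j))).comap_le

/-- The discrete process `X` is adapted to the filtration `G` and Markov with respect to it: for
every `j` with immediate predecessor `i`, the conditional law of `X j` given `G i` is a function
of `X i`. It is stated on the atoms `X i = a`, which is enough for countable state spaces. -/
structure IsMarkovFor (P : Measure Ω) (G : Filtration ι mΩ) (X : (i : ι) → Ω → E i) :
    Prop where
  adapted : ∀ i, Measurable[G i] (X i)
  transition : ∀ {i j}, i ⋖ j → ∀ a b, ∃ p : ℝ≥0,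
    HasCondProb P (G i) (X i ⁻¹' {a}) (X j ⁻¹' {b}) p

/-- The filtration of the pair of two independent observations, of `G` and of `G'`. -/
def prodFiltration (G : Filtration ι mΩ) (G' : Filtration ι mΩ') :
    Filtration ι (mΩ.prod mΩ') where
  seq i := (G i).prod (G' i)
  mono' _ _ h := sup_le_sup (MeasurableSpace.comap_mono (G.mono h))
    (MeasurableSpace.comap_mono (G'.mono h))
  le' i := sup_le_sup (MeasurableSpace.comap_mono (G.le i)) (MeasurableSpace.comap_mono (G'.le i))

namespace IsMarkovFor

variable {G : Filtration ι mΩ} {G' : Filtration ι mΩ'}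

theorem measurable (h : IsMarkovFor P G X) (i : ι) : Measurable (X i) :=
  (h.adapted i).mono (G.le i) le_rfl

theorem naturalFiltration_comp {B : κ → Type*} [∀ k, MeasurableSpace (B k)]
    {Z : (k : κ) → Ω → B k} {t : κ → ι} (h : IsMarkovFor P G X) (ht : Monotone t)
    (ht' : ∀ {k l}, k ⋖ l → t k ⋖ t l) (hZ : ∀ k, Measurable[G (t k)] (Z k))
    (hXZ : ∀ k, Measurable[naturalFiltration P Z k] (X (t k))) :
    IsMarkovFor P (naturalFiltration P Z) fun k => X (t k) where
  adapted := hXZ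
  transition {k _} hkl a b := by
    obtain ⟨p, hp⟩ := h.transition (ht' hkl) a b
    exact ⟨p, (hp.mono <| iSup_comap_le_of_measurable fun j hj =>
      (hZ j).mono (G.mono (ht hj)) le_rfl).completion⟩

theorem comp_measurePreserving {φ : Ω' → Ω} (h : IsMarkovFor P G X)
    [∀ i, MeasurableSingletonClass (E i)] (hφ : MeasurePreserving φ P' P)
    (hφG : ∀ i, Measurable[G' i, G i] φ) (hG : ∀ i, G' i ≤ (G i).comap φ) :
    IsMarkovFor P' G' fun i => X i ∘ φ where
  adapted i := (h.adapted i).comp (hφG i)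
  transition {i j} hij a b := by
    obtain ⟨p, hp⟩ := h.transition hij a b
    rw [← hφ.map_eq, hasCondProb_map_iff hφ.measurable (G.le i)
      (h.measurable i (measurableSet_singleton a)) (h.measurable j (measurableSet_singleton b))]
      at hp
    exact ⟨p, hp.mono (hG i)⟩

theorem comp_fst [SFinite P] [SFinite P'] [∀ i, MeasurableSingletonClass (E i)]
    (h : IsMarkovFor P G X) :
    IsMarkovFor (P.prod P') (prodFiltration G G') fun i x => X i x.1 where
  adapted i := (h.adapted i).comp (@measurable_fst _ _ (G i) (G' i))
  transition {i j} hij a b := (h.transition hij a b).imp fun _ hp =>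
    hp.prod_fst (G.le i) (G'.le i) (h.measurable i (measurableSet_singleton a))
      (h.measurable j (measurableSet_singleton b))

theorem comp_snd [SFinite P'] [∀ i, MeasurableSingletonClass (E i)]
    {X : (i : ι) → Ω' → E i} (h : IsMarkovFor P' G' X) :
    IsMarkovFor (P.prod P') (prodFiltration G G') fun i x => X i x.2 where
  adapted i := (h.adapted i).comp (@measurable_snd _ _ (G i) (G' i))
  transition {i j} hij a b := (h.transition hij a b).imp fun _ hp =>
    hp.prod_snd (G.le i) (G'.le i) (h.measurable i (measurableSet_singleton a))
      (h.measurable j (measurableSet_singleton b))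

theorem of_immersed {F : Filtration ι mΩ} [IsFiniteMeasure P]
    [∀ i, MeasurableSingletonClass (E i)] (h : IsMarkovFor P F X) (hFG : Immersed P F G) :
    IsMarkovFor P G X where
  adapted i := (h.adapted i).mono (hFG.1 i) le_rfl
  transition {i j} hij a b := (h.transition hij a b).imp fun _ hp =>
    (hFG.2 i j hij).hasCondProb (F.le i) (F.le j) (G.le i)
      (h.adapted i (measurableSet_singleton a)) (h.adapted j (measurableSet_singleton b)) hp

end IsMarkovFor

theorem IsMarkovFor.of_map_eq [∀ i, MeasurableSingletonClass (E i)] {G : Filtration ι mΩ}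
    {X' : (i : ι) → Ω' → E i} (h : IsMarkovFor P G X) (hX' : ∀ i, Measurable (X' i))
    (hlaw : P'.map (fun ω i => X' i ω) = P.map fun ω i => X i ω) :
    IsMarkovFor P' (naturalFiltration P' X') X' where
  adapted i := measurable_naturalFiltration hX' le_rfl
  transition {i j} hij a b := by
    obtain ⟨p, hp⟩ := h.transition hij a b
    have hpast : HasCondProb P (⨆ k ∈ Set.Iic i, MeasurableSpace.comap (X k) inferInstance)
        (X i ⁻¹' {a}) (X j ⁻¹' {b}) p := hp.mono <| iSup_comap_le_of_measurable fun k hk =>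
      (h.adapted k).mono (G.mono hk) le_rfl
    exact ⟨p, (hpast.of_map_eq h.measurable hX' hlaw.symm (measurableSet_singleton a)
      (measurableSet_singleton b)).completion⟩

end Markov

section Immersion

section ConditionalIndependence

variable {Ω : Type*} {F F' G mΩ : MeasurableSpace Ω} {P : Measure Ω} {B : Type*} [MeasurableSpace B]
  {V : Ω → B}

theorem exists_of_measurableSet_sup_comap {s : Set Ω}
    (hs : MeasurableSet[F ⊔ MeasurableSpace.comap V inferInstance] s) :
    ∃ S : B → Set Ω, (∀ b, MeasurableSet[F] (S b)) ∧ s = {ω | ω ∈ S (V ω)} := by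
  classical
  rw [MeasurableSpace.measurableSet_sup] at hs
  induction hs with
  | basic t ht =>
    rcases ht with ht | ⟨T, -, rfl⟩
    · exact ⟨fun _ => t, fun _ => ht, rfl⟩
    · exact ⟨fun b => {_ω | b ∈ T}, fun b => MeasurableSet.const _, rfl⟩
  | empty => exact ⟨fun _ => ∅, fun _ => MeasurableSet.empty, rfl⟩
  | compl t _ ih =>
    obtain ⟨S, hS, rfl⟩ := ih
    exact ⟨fun b => (S b)ᶜ, fun b => (hS b).compl, rfl⟩
  | iUnion f _ ih =>
    choose S hS hf using ih
    refine ⟨fun b => ⋃ n, S n b, fun b => MeasurableSet.iUnion fun n => hS n b, ?_⟩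
    ext ω
    simp only [Set.mem_iUnion, Set.mem_ofPred_eq]
    exact exists_congr fun n => by rw [hf n]; rfl

variable [IsFiniteMeasure P]

theorem condProb_eq_sum_indicator [Fintype B] [MeasurableSingletonClass B] (hV : Measurable V)
    (hF : F ≤ mΩ) {S : B → Set Ω} (hS : ∀ b, MeasurableSet[F] (S b)) :
    P⟦{ω | ω ∈ S (V ω)} | F⟧ =ᵐ[P] ∑ b, (S b).indicator (P⟦V ⁻¹' {b} | F⟧) := by
  classical
  have hint (b : B) : Integrable ((V ⁻¹' {b}).indicator fun _ => (1 : ℝ)) P :=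
    (integrable_const 1).indicator (hV (measurableSet_singleton b))
  have hsum : ({ω | ω ∈ S (V ω)} : Set Ω).indicator (fun _ => (1 : ℝ)) =
      ∑ b, (S b).indicator ((V ⁻¹' {b}).indicator fun _ => (1 : ℝ)) := by
    funext ω
    rw [Finset.sum_apply, Finset.sum_eq_single (V ω)]
    · simp [Set.indicator_apply]
    · intro b _ hb
      simp [Set.indicator_apply, hb.symm]
    · simp
  rw [hsum]
  refine (condExp_finsetSum (fun b _ => (hint b).indicator (hF _ (hS b))) F).trans ?_
  exact eventuallyEq_sum fun b _ => condExp_indicator (hint b) (hS b)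

theorem condProb_eq_of_forall_singleton [Finite B] [MeasurableSingletonClass B]
    (hV : Measurable V) (hFG : F ≤ G) (hG : G ≤ mΩ)
    (h : ∀ b, P⟦V ⁻¹' {b} | G⟧ =ᵐ[P] P⟦V ⁻¹' {b} | F⟧) {s : Set Ω}
    (hs : MeasurableSet[F ⊔ MeasurableSpace.comap V inferInstance] s) :
    P⟦s | G⟧ =ᵐ[P] P⟦s | F⟧ := by
  cases nonempty_fintype B
  obtain ⟨S, hS, rfl⟩ := exists_of_measurableSet_sup_comap hs
  calc P⟦{ω | ω ∈ S (V ω)} | G⟧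
      =ᵐ[P] ∑ b, (S b).indicator (P⟦V ⁻¹' {b} | G⟧) :=
        condProb_eq_sum_indicator hV hG fun b => hFG _ (hS b)
    _ =ᵐ[P] ∑ b, (S b).indicator (P⟦V ⁻¹' {b} | F⟧) :=
        eventuallyEq_sum fun b _ => (h b).indicator
    _ =ᵐ[P] P⟦{ω | ω ∈ S (V ω)} | F⟧ :=
        (condProb_eq_sum_indicator hV (hFG.trans hG) hS).symm

theorem condProb_eq_of_hasCondProb {A : Type*} [Countable A] [MeasurableSpace A]
    [MeasurableSingletonClass A] {U : Ω → A} {u : Set Ω} {p : A → ℝ≥0} (hU : Measurable[F] U)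
    (hu : MeasurableSet u) (hFG : F ≤ G) (hG : G ≤ mΩ)
    (h : ∀ a, HasCondProb P G (U ⁻¹' {a}) u (p a)) : P⟦u | G⟧ =ᵐ[P] P⟦u | F⟧ := by
  have hp {H : MeasurableSpace Ω} (hFH : F ≤ H) (hHG : H ≤ G) :
      ∀ᵐ ω ∂P, (P⟦u | H⟧) ω = p (U ω) := by
    have hall := ae_all_iff.2 fun a => ((h a).mono hHG).condExp_eq (hHG.trans hG)
      (hFH _ (hU (measurableSet_singleton a))) hu
    filter_upwards [hall] with ω hω using hω (U ω) rfl
  filter_upwards [hp hFG le_rfl, hp le_rfl hFG] with ω hωG hωF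
  rw [hωG, hωF]

theorem condIndepSigma_of_condProb_eq (hFG : F ≤ G) (hG : G ≤ mΩ) (hF' : F' ≤ mΩ)
    (h : ∀ s, MeasurableSet[F'] s → P⟦s | G⟧ =ᵐ[P] P⟦s | F⟧) : CondIndepSigma P F F' G := by
  intro s t hs ht
  have hint {r : Set Ω} (hr : MeasurableSet r) : Integrable (r.indicator fun _ => (1 : ℝ)) P :=
    (integrable_const 1).indicator hr
  have hmul : t.indicator (P⟦s | F⟧) = P⟦s | F⟧ * t.indicator fun _ => (1 : ℝ) := by
    funext ω
    by_cases hω : ω ∈ t <;> simp [hω]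
  calc P⟦s ∩ t | F⟧
      =ᵐ[P] P[P⟦s ∩ t | G⟧ | F] := (condExp_condExp_of_le hFG hG).symm
    _ =ᵐ[P] P[t.indicator (P⟦s | F⟧) | F] := by
        refine condExp_congr_ae ?_
        rw [Set.inter_comm, ← Set.indicator_indicator]
        exact (condExp_indicator (hint (hF' s hs)) ht).trans (h s hs).indicator
    _ =ᵐ[P] P⟦s | F⟧ * P⟦t | F⟧ := by
        rw [hmul]
        exact condExp_mul_of_stronglyMeasurable_left stronglyMeasurable_condExp
          (hmul ▸ integrable_condExp.indicator (hG t ht)) (hint (hG t ht))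

end ConditionalIndependence

variable {Ω Ω' ι : Type*} {mΩ : MeasurableSpace Ω} {mΩ' : MeasurableSpace Ω'} {P : Measure Ω}
  {E : ι → Type*} [∀ i, MeasurableSpace (E i)] [∀ i, MeasurableSingletonClass (E i)]

theorem IsMarkov.isMarkovFor [Preorder ι] {X : (i : ι) → Ω → E i} [IsFiniteMeasure P]
    (h : IsMarkov P X) (hX : ∀ i, Measurable (X i)) :
    IsMarkovFor P (naturalFiltration P X) X where
  adapted i := measurable_naturalFiltration hX le_rfl
  transition {i j} hij a b := by
    obtain ⟨g, -, hg⟩ : ∃ g : E i → ℝ, Measurable g ∧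
        P⟦X j ⁻¹' {b} | MeasurableSpace.comap (X i) inferInstance⟧ = g ∘ X i :=
      stronglyMeasurable_condExp.measurable.exists_eq_measurable_comp
    have ha := measurable_naturalFiltration (P := P) hX le_rfl (measurableSet_singleton a)
    have hga : ∀ t, MeasurableSet[naturalFiltration P X i] t →
        P.real (t ∩ X i ⁻¹' {a} ∩ X j ⁻¹' {b}) = g a * P.real (t ∩ X i ⁻¹' {a}) := fun t ht => by
      rw [← setIntegral_condProb ((naturalFiltration P X).le i) (ht.inter ha)
        (hX j (measurableSet_singleton b)), mul_comm, ← smul_eq_mul, ← setIntegral_const]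
      refine setIntegral_congr_ae ((naturalFiltration P X).le i _ (ht.inter ha)) ?_
      filter_upwards [h i j hij {b} (measurableSet_singleton b)] with ω hω hωa
      rw [hω, hg, Function.comp_apply, show X i ω = a from hωa.2]
    refine ⟨(g a).toNNReal, hasCondProb_iff_measureReal.2 fun t ht => ?_⟩
    rw [hga t ht, Real.coe_toNNReal']
    -- `g a` is negative only if `X i = a` is negligible, and then both sides vanish.
    rcases le_total 0 (g a) with hg0 | hg0
    · rw [max_eq_left hg0]
    · have : 0 ≤ g a * P.real (t ∩ X i ⁻¹' {a}) := hga t ht ▸ measureReal_nonneg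
      rw [max_eq_right hg0, zero_mul]
      exact le_antisymm (mul_nonpos_of_nonpos_of_nonneg hg0 measureReal_nonneg) this

namespace IsNonAnticipativeCoupling

variable [Preorder ι] [IsFiniteMeasure P] {μ : Measure Ω'} {X : (i : ι) → Ω' → E i}
  {X' X'' : (i : ι) → Ω → E i} {F : Filtration ι mΩ'}

theorem isMarkovFor_left (h : IsNonAnticipativeCoupling μ X P X' X'')
    (hX : IsMarkovFor μ F X) :
    IsMarkovFor P (naturalFiltration P fun i ω => (X' i ω, X'' i ω)) X' :=
  (hX.of_map_eq h.measurable_left h.law_left).of_immersed h.immersed_left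

theorem isMarkovFor_right (h : IsNonAnticipativeCoupling μ X P X' X'')
    (hX : IsMarkovFor μ F X) :
    IsMarkovFor P (naturalFiltration P fun i ω => (X' i ω, X'' i ω)) X'' :=
  (hX.of_map_eq h.measurable_right h.law_right).of_immersed h.immersed_right

end IsNonAnticipativeCoupling

variable [LinearOrder ι] [∀ i, Finite (E i)] [IsFiniteMeasure P]

theorem IsMarkovFor.immersed {X : (i : ι) → Ω → E i} {G : Filtration ι mΩ}
    (h : IsMarkovFor P G X) (hG : ∀ i, naturalFiltration P X i ≤ G i) :
    Immersed P (naturalFiltration P X) G := by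
  refine ⟨hG, fun i j hij => ?_⟩
  have hX {k l : ι} (hkl : k ≤ l) : Measurable[naturalFiltration P X l] (X k) :=
    measurable_naturalFiltration h.measurable hkl
  refine condIndepSigma_of_condProb_eq (hG i) (G.le i) ((naturalFiltration P X).le j) fun s hs => ?_
  obtain ⟨⟨t, ht, hst⟩, -⟩ := measurableSet_completion_iff.1 hs
  have hst' := indicator_ae_eq_of_ae_eq_set (f := fun _ => (1 : ℝ)) hst
  have hF' : (⨆ k ≤ j, MeasurableSpace.comap (X k) inferInstance) ≤
      naturalFiltration P X i ⊔ MeasurableSpace.comap (X j) inferInstance := by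
    refine iSup₂_le fun k hk => ?_
    rcases hk.lt_or_eq with hk | rfl
    · exact (hX (hij.le_of_lt hk)).comap_le.trans le_sup_left
    · exact le_sup_right
  choose p hp using h.transition hij
  calc P⟦s | G i⟧ =ᵐ[P] P⟦t | G i⟧ := condExp_congr_ae hst'
    _ =ᵐ[P] P⟦t | naturalFiltration P X i⟧ :=
        condProb_eq_of_forall_singleton (h.measurable j) (hG i) (G.le i) (fun b =>
          condProb_eq_of_hasCondProb (hX le_rfl) (h.measurable j (measurableSet_singleton b))
            (hG i) (G.le i) fun a => hp a b) (hF' t ht)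
    _ =ᵐ[P] P⟦s | naturalFiltration P X i⟧ := (condExp_congr_ae hst').symm

theorem IsMarkovFor.immersed_comp {B : ι → Type*} [∀ i, MeasurableSpace (B i)]
    {Z : (i : ι) → Ω → B i} {φ : (i : ι) → B i → E i} {G : Filtration ι mΩ}
    (h : IsMarkovFor P G fun i ω => φ i (Z i ω)) (hZ : ∀ i, Measurable[G i] (Z i))
    (hφ : ∀ i, Measurable (φ i)) :
    Immersed P (naturalFiltration P fun i ω => φ i (Z i ω)) (naturalFiltration P Z) :=
  have hZ' (i : ι) : Measurable[naturalFiltration P Z i] (Z i) :=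
    measurable_naturalFiltration (fun j => (hZ j).mono (G.le j) le_rfl) le_rfl
  (h.naturalFiltration_comp (t := id) monotone_id id hZ fun i => (hφ i).comp (hZ' i)).immersed
    (naturalFiltration_comp_le hφ)

namespace IsNonAnticipativeCoupling

variable {μ : Measure Ω'} {X : (i : ι) → Ω' → E i} {X' X'' : (i : ι) → Ω → E i}

theorem of_isMarkovFor {G : Filtration ι mΩ} (h' : IsMarkovFor P G X') (h'' : IsMarkovFor P G X'')
    (hlaw' : P.map (fun ω i => X' i ω) = μ.map fun ω i => X i ω)
    (hlaw'' : P.map (fun ω i => X'' i ω) = μ.map fun ω i => X i ω) :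
    IsNonAnticipativeCoupling μ X P X' X'' :=
  let Z (i : ι) (ω : Ω) : E i × E i := (X' i ω, X'' i ω)
  have hZ (i : ι) : Measurable[G i] (Z i) := (h'.adapted i).prodMk (h''.adapted i)
  ⟨h'.measurable, h''.measurable, hlaw', hlaw'',
    h'.immersed_comp (Z := Z) (φ := fun _ => Prod.fst) hZ fun _ => measurable_fst,
    h''.immersed_comp (Z := Z) (φ := fun _ => Prod.snd) hZ fun _ => measurable_snd⟩

theorem comp {κ : Type*} [LinearOrder κ] {t : κ → ι}
    (h : IsNonAnticipativeCoupling μ X P X' X'') {F : Filtration ι mΩ'} (hX : IsMarkovFor μ F X)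
    (ht : Monotone t) (ht' : ∀ {k l}, k ⋖ l → t k ⋖ t l) :
    IsNonAnticipativeCoupling μ (fun k => X (t k)) P (fun k => X' (t k)) fun k => X'' (t k) := by
  have hZ : ∀ i, Measurable fun ω => (X' i ω, X'' i ω) := fun i =>
    (h.measurable_left i).prodMk (h.measurable_right i)
  have hZt (k : κ) : Measurable[naturalFiltration P (fun k ω => (X' (t k) ω, X'' (t k) ω)) k]
      fun ω => (X' (t k) ω, X'' (t k) ω) :=
    measurable_naturalFiltration (fun k => hZ (t k)) le_rfl
  have hlaw {Y : (i : ι) → Ω → E i} (hY : ∀ i, Measurable (Y i))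
      (hYX : P.map (fun ω i => Y i ω) = μ.map fun ω i => X i ω) :
      P.map (fun ω k => Y (t k) ω) = μ.map fun ω k => X (t k) ω := by
    have hrestr : Measurable fun (x : (i : ι) → E i) k => x (t k) := by fun_prop
    have := congrArg (Measure.map fun (x : (i : ι) → E i) k => x (t k)) hYX
    rwa [Measure.map_map hrestr (measurable_pi_lambda _ hY),
      Measure.map_map hrestr (measurable_pi_lambda _ hX.measurable)] at this
  refine of_isMarkovFor
    ((h.isMarkovFor_left hX).naturalFiltration_comp ht ht'
      (fun k => measurable_naturalFiltration hZ le_rfl) fun k => measurable_fst.comp (hZt k))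
    ((h.isMarkovFor_right hX).naturalFiltration_comp ht ht'
      (fun k => measurable_naturalFiltration hZ le_rfl) fun k => measurable_snd.comp (hZt k))
    (hlaw h.measurable_left h.law_left) (hlaw h.measurable_right h.law_right)

end IsNonAnticipativeCoupling

end Immersion

section Isomorphism

variable {Ω Ω' : Type*} {m m' mΩ : MeasurableSpace Ω} {mΩ' : MeasurableSpace Ω'}
  {μ : Measure Ω} {μ' : Measure Ω'}

theorem exists_measurable_ae_eq_of_completion {E : Type*} [MeasurableSpace E]
    [StandardBorelSpace E] [Nonempty E] {f : Ω → E} (hf : Measurable[completion μ m] f) :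
    ∃ g : Ω → E, Measurable[m] g ∧ f =ᵐ[μ] g := by
  classical
  have hcode : MeasurableEmbedding (MeasurableSpace.mapNatBool E) :=
    (MeasurableSpace.measurable_mapNatBool E).measurableEmbedding
      (MeasurableSpace.injective_mapNatBool E)
  have hbit (n : ℕ) : ∃ t, MeasurableSet[m] t ∧
      {ω | MeasurableSpace.mapNatBool E (f ω) n = true} =ᵐ[μ] t :=
    (measurableSet_completion_iff.1 <| ((measurable_pi_apply n).comp hcode.measurable).comp hf
      (measurableSet_singleton true)).1
  choose t ht hft using hbit
  let code (ω : Ω) (n : ℕ) : Bool := decide (ω ∈ t n)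
  have hcodem : Measurable[m] code := by
    refine @measurable_pi_lambda _ _ _ m _ _ fun n => @measurable_to_bool _ m _ ?_
    simpa [code, Set.preimage] using ht n
  refine ⟨hcode.invFun ∘ code, hcode.measurable_invFun.comp hcodem, ?_⟩
  filter_upwards [ae_all_iff.2 fun n => (hft n).mem_iff] with ω hω
  have hcodeω : code ω = MeasurableSpace.mapNatBool E (f ω) := by
    funext n
    exact Bool.eq_iff_iff.2 (by simpa [code] using (hω n).symm)
  rw [Function.comp_apply, hcodeω, hcode.leftInverse_invFun]

theorem L0_mono (h : m ≤ m') : L0 μ m ⊆ L0 μ m' := fun _ hf => AEStronglyMeasurable.mono h hf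

theorem L0.exists_ae_eq (hm : m ≤ mΩ) {f : Ω → ℝ} (hf : Measurable[m] f) :
    ∃ Y ∈ L0 μ m, Y =ᵐ[μ] f := by
  have hae := AEEqFun.coeFn_mk (μ := μ) f (hf.mono hm le_rfl).aestronglyMeasurable
  exact ⟨AEEqFun.mk f _, ⟨f, hf.stronglyMeasurable, hae⟩, hae⟩

theorem L0.measurable_completion {Y : Ω →ₘ[μ] ℝ} (hY : Y ∈ L0 μ m) :
    Measurable[completion μ m] Y := by
  obtain ⟨f, hf, hYf⟩ := hY
  exact fun s hs => measurableSet_completion_iff.2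
    ⟨⟨f ⁻¹' s, hf.measurable hs, hYf.preimage s⟩, Y.measurable hs⟩

variable {ι : Type*} [Preorder ι] {F : Filtration ι mΩ} {F' : Filtration ι mΩ'}

theorem map_apply_eq_of_ae_eq_indicator {W : ℕ → Ω →ₘ[μ] ℝ} {U : Ω →ₘ[μ] ℝ} {A : Set (ℕ → ℝ)}
    (hA : MeasurableSet A) (hU : U =ᵐ[μ] fun ω => A.indicator (fun _ => (1 : ℝ)) fun k => W k ω) :
    μ.map (fun ω k => W k ω) A = μ.map U {1} := by
  rw [Measure.map_apply (measurable_pi_lambda _ fun k => (W k).measurable) hA,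
    Measure.map_apply U.measurable (measurableSet_singleton 1)]
  refine measure_congr (eventuallyEq_set.2 ?_)
  filter_upwards [hU] with ω hω
  simp [hω]

namespace FilteredIso

theorem exists_borel (Ψ : FilteredIso μ F μ' F') (Y : ℕ → L0 μ (⨆ i, F i)) {Φ : (ℕ → ℝ) → ℝ}
    (hΦ : Measurable Φ) :
    ∃ Z : L0 μ (⨆ i, F i), Z.1 =ᵐ[μ] (fun ω => Φ fun k => (Y k).1 ω) ∧
      (Ψ.toEquiv Z).1 =ᵐ[μ'] fun ω => Φ fun k => (Ψ.toEquiv (Y k)).1 ω := by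
  choose f hf hYf using fun k => (Y k).2
  obtain ⟨Z, hZ, hZf⟩ := L0.exists_ae_eq (μ := μ) (iSup_le F.le)
    (hΦ.comp (@measurable_pi_lambda _ _ _ (⨆ i, F i) _ (fun ω k => f k ω) fun k =>
      (hf k).measurable))
  have hZY : Z =ᵐ[μ] fun ω => Φ fun k => (Y k).1 ω := by
    filter_upwards [hZf, ae_all_iff.2 hYf] with ω hω hfω
    simp only [hω, Function.comp_apply, hfω]
  exact ⟨⟨Z, hZ⟩, hZY, Ψ.comm_borel Y Φ hΦ ⟨Z, hZ⟩ hZY⟩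

theorem map_seq_eq (Ψ : FilteredIso μ F μ' F') (Y : ℕ → L0 μ (⨆ i, F i)) :
    μ'.map (fun ω k => (Ψ.toEquiv (Y k)).1 ω) = μ.map fun ω k => (Y k).1 ω := by
  ext A hA
  obtain ⟨Z, hZ, hΨZ⟩ := Ψ.exists_borel Y (measurable_const.indicator hA : Measurable
    (A.indicator fun _ => (1 : ℝ)))
  rw [map_apply_eq_of_ae_eq_indicator hA hZ, map_apply_eq_of_ae_eq_indicator hA hΨZ, Ψ.law_eq]

theorem map_eq (Ψ : FilteredIso μ F μ' F') [IsFiniteMeasure μ] :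
    μ'.map (fun ω (Y : L0 μ (⨆ i, F i)) => (Ψ.toEquiv Y).1 ω) = μ.map fun ω Y => Y.1 ω := by
  refine IsProjectiveLimit.unique (fun I => ?_)
    (isProjectiveLimit_map (measurable_pi_lambda _ fun Y => Y.1.measurable).aemeasurable)
  obtain ⟨Y₀, hY₀, -⟩ := L0.exists_ae_eq (μ := μ) (iSup_le F.le) (measurable_const (a := (0 : ℝ)))
  have : Nonempty (L0 μ (⨆ i, F i)) := ⟨⟨Y₀, hY₀⟩⟩
  obtain ⟨Y, hY⟩ := Set.countable_iff_exists_subset_range.1 I.countable_toSet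
  choose k hk using fun Z : I => hY Z.2
  have hk' : Measurable fun (x : ℕ → ℝ) (Z : I) => x (k Z) := by fun_prop
  have hmap := congrArg (Measure.map fun x Z => x (k Z)) (Ψ.map_seq_eq Y)
  rw [Measure.map_map hk' (measurable_pi_lambda _ fun n => (Ψ.toEquiv (Y n)).1.measurable),
    Measure.map_map hk' (measurable_pi_lambda _ fun n => (Y n).1.measurable)] at hmap
  rw [isProjectiveLimit_map
    (measurable_pi_lambda _ fun Z => (Ψ.toEquiv Z).1.measurable).aemeasurable]
  simp only [Function.comp_def, hk] at hmap
  exact hmap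

theorem map_process_eq (Ψ : FilteredIso μ F μ' F') [IsFiniteMeasure μ] {T : Type*} {E : T → Type*}
    [∀ i, MeasurableSpace (E i)] (Z : T → L0 μ (⨆ i, F i)) {φ : (i : T) → ℝ → E i}
    (hφ : ∀ i, Measurable (φ i)) :
    μ'.map (fun ω i => φ i ((Ψ.toEquiv (Z i)).1 ω)) = μ.map fun ω i => φ i ((Z i).1 ω) := by
  have hmap := congrArg (Measure.map fun x i => φ i (x (Z i))) Ψ.map_eq
  have hφ' : Measurable fun (x : L0 μ (⨆ i, F i) → ℝ) i => φ i (x (Z i)) :=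
    measurable_pi_lambda _ fun i => (hφ i).comp (measurable_pi_apply (Z i))
  rwa [Measure.map_map hφ' (measurable_pi_lambda _ fun V => (Ψ.toEquiv V).1.measurable),
    Measure.map_map hφ' (measurable_pi_lambda _ fun V => V.1.measurable)] at hmap

theorem toEquiv_mem_L0 (Ψ : FilteredIso μ F μ' F') {i : ι} {Y : L0 μ (⨆ i, F i)}
    (hY : Y.1 ∈ L0 μ (F i)) : (Ψ.toEquiv Y).1 ∈ L0 μ' (F' i) := by
  have hgen : (MeasurableSpace.comap (Ψ.toEquiv Y).1 inferInstance) ≤ completion μ' (F' i) := by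
    rw [← Ψ.generate i]
    refine le_trans ?_ (le_completion <| iSup₂_le fun Z _ => (Ψ.toEquiv Z).1.measurable.comap_le)
    exact le_iSup₂_of_le Y hY le_rfl
  obtain ⟨g, hg, hYg⟩ := exists_measurable_ae_eq_of_completion (measurable_iff_comap_le.2 hgen)
  exact ⟨g, hg.stronglyMeasurable, hYg⟩

theorem hasCondProb (Ψ : FilteredIso μ F μ' F') [IsFiniteMeasure μ] {i : ι}
    {Y Z : L0 μ (⨆ i, F i)} {s u : Set ℝ} (hs : MeasurableSet s) (hu : MeasurableSet u) {p : ℝ≥0}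
    (h : HasCondProb μ (F i) (Y.1 ⁻¹' s) (Z.1 ⁻¹' u) p) :
    HasCondProb μ' (F' i) ((Ψ.toEquiv Y).1 ⁻¹' s) ((Ψ.toEquiv Z).1 ⁻¹' u) p := by
  have hpast : HasCondProb μ (⨆ V ∈ {V : L0 μ (⨆ i, F i) | V.1 ∈ L0 μ (F i)},
      MeasurableSpace.comap V.1 inferInstance) (Y.1 ⁻¹' s) (Z.1 ⁻¹' u) p :=
    h.completion.mono <| iSup₂_le fun V hV => (L0.measurable_completion hV).comap_le
  exact (hpast.of_map_eq (fun V => V.1.measurable) (fun V => (Ψ.toEquiv V).1.measurable)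
    Ψ.map_eq.symm hs hu).completion.mono ((le_completion (F'.le i)).trans (Ψ.generate i).ge)

theorem exists_isMarkovFor (Ψ : FilteredIso μ F μ' F') [IsFiniteMeasure μ] [IsFiniteMeasure μ']
    {E : ι → Type*} [∀ i, MeasurableSpace (E i)] [∀ i, StandardBorelSpace (E i)]
    [∀ i, Nonempty (E i)] {X : (i : ι) → Ω → E i} (hX : IsMarkovFor μ F X) :
    ∃ X' : (i : ι) → Ω' → E i, IsMarkovFor μ' F' X' ∧
      μ'.map (fun ω i => X' i ω) = μ.map fun ω i => X i ω := by
  let code (i : ι) := embeddingReal (E i)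
  have hcode (i : ι) : MeasurableEmbedding (code i) := measurableEmbedding_embeddingReal (E i)
  let decode (i : ι) : ℝ → E i := (hcode i).invFun
  have hdecode (i : ι) : Measurable (decode i) := (hcode i).measurable_invFun
  choose Y hY hYX using fun i =>
    L0.exists_ae_eq (μ := μ) (F.le i) ((hcode i).measurable.comp (hX.adapted i))
  let Z (i : ι) : L0 μ (⨆ i, F i) := ⟨Y i, L0_mono (le_iSup F i) (hY i)⟩
  choose y hy hZy using fun i => Ψ.toEquiv_mem_L0 (Y := Z i) (hY i)
  have hZX (i : ι) : (fun ω => decode i ((Z i).1 ω)) =ᵐ[μ] X i := by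
    filter_upwards [hYX i] with ω hω
    exact (congrArg (decode i) hω).trans ((hcode i).leftInverse_invFun (X i ω))
  have hZy' (i : ι) : (fun ω => decode i ((Ψ.toEquiv (Z i)).1 ω)) =ᵐ[μ'] decode i ∘ y i :=
    (hZy i).fun_comp (decode i)
  refine ⟨fun i => decode i ∘ y i, ⟨fun i => (hdecode i).comp (hy i).measurable,
    fun {i j} hij a b => ?_⟩, ?_⟩
  · obtain ⟨p, hp⟩ := hX.transition hij a b
    have hp' := hp.congr ((hZX i).symm.preimage {a}) ((hZX j).symm.preimage {b})
    exact ⟨p, (Ψ.hasCondProb (hdecode i (measurableSet_singleton a))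
      (hdecode j (measurableSet_singleton b)) hp').congr
        ((hZy' i).preimage {a}) ((hZy' j).preimage {b})⟩
  · have hlaw := Ψ.map_process_eq Z hdecode
    rwa [map_eq_of_forall_ae_eq ?_ ?_ hZX, map_eq_of_forall_ae_eq ?_ ?_ hZy'] at hlaw
    all_goals refine (measurable_pi_lambda _ fun i => ?_).aemeasurable
    · exact (hdecode i).comp (Ψ.toEquiv (Z i)).1.measurable
    · exact (hdecode i).comp ((hy i).measurable.mono (F'.le i) le_rfl)
    · exact (hdecode i).comp (Z i).1.measurable
    · exact hX.measurable i

end FilteredIso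

end Isomorphism

section Standardness

variable {Ω ι : Type*} [Preorder ι] {mΩ : MeasurableSpace Ω} {P : Measure Ω}
  {E : ι → Type*} [∀ i, MeasurableSpace (E i)] {X : (i : ι) → Ω → E i}

theorem comap_piLE (X : (i : ι) → Ω → E i) (i : ι) :
    (Filtration.piLE (X := E) i).comap (fun ω j => X j ω) =
      ⨆ j ≤ i, MeasurableSpace.comap (X j) inferInstance := by
  simp only [Filtration.piLE, MeasurableSpace.comap_comp, MeasurableSpace.pi,
    MeasurableSpace.comap_iSup]
  exact iSup_subtype (f := fun j : Set.Iic i => MeasurableSpace.comap (X j) inferInstance)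

theorem measurable_piLE_iff {α : Type*} {m : MeasurableSpace α} {i : ι} {g : α → (i : ι) → E i} :
    Measurable[m, Filtration.piLE i] g ↔ ∀ j ≤ i, Measurable[m] fun a => g a j := by
  rw [measurable_iff_comap_le, comap_piLE (fun j a => g a j)]
  simp only [iSup_le_iff, measurable_iff_comap_le]

theorem IsMarkovFor.exists_of_naturalFiltration [IsFiniteMeasure P] {B : ι → Type*}
    [∀ i, MeasurableSpace (B i)] [∀ i, StandardBorelSpace (E i)] [∀ i, Nonempty (E i)]
    {V : (i : ι) → Ω → B i} (hV : ∀ i, Measurable (V i))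
    (hX : IsMarkovFor P (naturalFiltration P V) X) :
    ∃ f : (i : ι) → ((j : ι) → B j) → E i,
      IsMarkovFor (P.map fun ω i => V i ω) Filtration.piLE f ∧
        (P.map fun ω i => V i ω).map (fun v i => f i v) = P.map fun ω i => X i ω := by
  choose Y hY hXY using fun i => exists_measurable_ae_eq_of_completion (hX.adapted i)
  have hYf (i : ι) : ∃ f : ((j : ι) → B j) → E i, Measurable[Filtration.piLE i] f ∧
      Y i = f ∘ fun ω j => V j ω := by
    exact Measurable.exists_eq_measurable_comp (mY := Filtration.piLE i)
      (by rw [comap_piLE]; exact hY i)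
  choose f hf hYf using hYf
  have hVπ : Measurable fun ω i => V i ω := measurable_pi_lambda _ hV
  have hfm (i : ι) : Measurable (f i) := (hf i).mono (Filtration.piLE.le i) le_rfl
  have hXf (i : ι) : X i =ᵐ[P] fun ω => f i fun j => V j ω := (hXY i).trans (by rw [hYf]; rfl)
  refine ⟨f, ⟨hf, fun {i j} hij a b => ?_⟩, ?_⟩
  · obtain ⟨p, hp⟩ := hX.transition hij a b
    refine ⟨p, (hasCondProb_map_iff hVπ (Filtration.piLE.le i) (hfm i (measurableSet_singleton a))
      (hfm j (measurableSet_singleton b))).2 ?_⟩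
    rw [comap_piLE]
    exact (hp.congr ((hXf i).preimage {a}) ((hXf j).preimage {b})).mono
      (le_completion <| iSup_comap_le_of_measurable fun j _ => hV j)
  · rw [Measure.map_map (measurable_pi_lambda _ hfm) hVπ]
    exact (map_eq_of_forall_ae_eq (measurable_pi_lambda _ hX.measurable).aemeasurable
      (measurable_pi_lambda _ fun i => (hfm i).comp hVπ).aemeasurable hXf).symm

theorem IsStandard.exists_isMarkovFor_infinitePi {F : Filtration ι mΩ} [IsFiniteMeasure P]
    [∀ i, StandardBorelSpace (E i)] [∀ i, Nonempty (E i)] (h : IsStandard P F)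
    (hX : IsMarkovFor P F X) :
    ∃ ν : ι → Measure ℝ, (∀ i, IsProbabilityMeasure (ν i)) ∧ ∃ f : (i : ι) → (ι → ℝ) → E i,
      IsMarkovFor (Measure.infinitePi ν) Filtration.piLE f ∧
        (Measure.infinitePi ν).map (fun v i => f i v) = P.map fun ω i => X i ω := by
  obtain ⟨Ω', mΩ', P', F', G', hP', ⟨Ψ⟩, ⟨V, hV, hind, rfl⟩, hF'G'⟩ := h
  obtain ⟨X', hX', hlaw'⟩ := Ψ.exists_isMarkovFor hX
  obtain ⟨f, hf, hlaw⟩ := (hX'.of_immersed hF'G').exists_of_naturalFiltration hV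
  rw [hind.map_fun_eq_infinitePi_map hV] at hf hlaw
  exact ⟨fun i => P'.map (V i), fun i => Measure.isProbabilityMeasure_map (hV i).aemeasurable,
    f, hf, hlaw.trans hlaw'⟩

end Standardness

section Cosiness

section Swap

variable {ι B : Type*}

/-- The exchange of the coordinates that belong to `S` of two families. On a product of two copies
of a product measure, it resamples these coordinates of the first family. -/
def swapOn (S : Set ι) [DecidablePred (· ∈ S)] (x : (ι → B) × (ι → B)) : (ι → B) × (ι → B) :=
  (S.piecewise x.2 x.1, S.piecewise x.1 x.2)

theorem swapOn_involutive (S : Set ι) [DecidablePred (· ∈ S)] :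
    Function.Involutive (swapOn (B := B) S) := by
  intro x
  refine Prod.ext (funext fun i => ?_) (funext fun i => ?_) <;>
    by_cases hi : i ∈ S <;> simp [swapOn, hi]

variable [MeasurableSpace B]

theorem measurable_sumElim {κ : Type*} :
    Measurable fun x : (ι → B) × (κ → B) => Sum.elim x.1 x.2 :=
  measurable_pi_iff.2 <| by
    rintro (i | k) <;> simp only [Sum.elim_inl, Sum.elim_inr] <;> fun_prop

theorem map_sumElim_infinitePi {κ : Type*} (ν : ι → Measure B) [∀ i, IsProbabilityMeasure (ν i)]
    (ρ : κ → Measure B) [∀ k, IsProbabilityMeasure (ρ k)]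
    [∀ i, IsProbabilityMeasure (Sum.elim ν ρ i)] :
    ((Measure.infinitePi ν).prod (Measure.infinitePi ρ)).map (fun x => Sum.elim x.1 x.2) =
      Measure.infinitePi (Sum.elim ν ρ) := by
  refine Measure.eq_infinitePi _ fun I t ht => ?_
  have hpre : (fun x : (ι → B) × (κ → B) => Sum.elim x.1 x.2) ⁻¹' (I : Set (ι ⊕ κ)).pi t =
      (I.toLeft : Set ι).pi (fun i => t (.inl i)) ×ˢ
        (I.toRight : Set κ).pi fun k => t (.inr k) := by
    ext x
    simp [Set.mem_pi]
  rw [Measure.map_apply measurable_sumElim (.pi I.countable_toSet fun i _ => ht i), hpre,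
    Measure.prod_prod, Measure.infinitePi_pi _ fun i _ => ht _,
    Measure.infinitePi_pi _ fun k _ => ht _]
  conv_rhs => rw [← I.toLeft_disjSum_toRight, Finset.prod_disjSum]
  rfl

theorem measurePreserving_swapOn (ν : ι → Measure B) [∀ i, IsProbabilityMeasure (ν i)]
    (S : Set ι) [DecidablePred (· ∈ S)] :
    MeasurePreserving (swapOn S) ((Measure.infinitePi ν).prod (Measure.infinitePi ν))
      ((Measure.infinitePi ν).prod (Measure.infinitePi ν)) := by
  let zip (x : (ι → B) × (ι → B)) : ι ⊕ ι → B := Sum.elim x.1 x.2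
  let unzip (w : ι ⊕ ι → B) : (ι → B) × (ι → B) := (fun i => w (.inl i), fun i => w (.inr i))
  let σ (i : ι ⊕ ι) : ι ⊕ ι := if Sum.elim id id i ∈ S then i.swap else i
  have hσ : Function.Involutive σ := by
    rintro (i | i) <;> by_cases hi : i ∈ S <;> simp [σ, hi]
  have (i : ι ⊕ ι) : IsProbabilityMeasure (Sum.elim ν ν i) := by
    cases i <;> simp only [Sum.elim_inl, Sum.elim_inr] <;> infer_instance
  have hzip : Measurable zip := measurable_sumElim
  have hunzip : Measurable unzip := by fun_prop
  have hσ' : Measurable fun (w : ι ⊕ ι → B) i => w (σ i) := by fun_prop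
  have hswap : swapOn S = unzip ∘ (fun w i => w (σ i)) ∘ zip := by
    funext x
    refine Prod.ext (funext fun i => ?_) (funext fun i => ?_) <;>
      by_cases hi : i ∈ S <;> simp [swapOn, unzip, σ, zip, hi]
  have hνσ : (fun i => Sum.elim ν ν (σ i)) = Sum.elim ν ν := by
    funext i
    rcases i with i | i <;> by_cases hi : i ∈ S <;> simp [σ, hi]
  refine ⟨hswap ▸ hunzip.comp (hσ'.comp hzip), ?_⟩
  rw [hswap, ← Measure.map_map hunzip (hσ'.comp hzip), ← Measure.map_map hσ' hzip,
    map_sumElim_infinitePi ν ν, Measure.map_infinitePi_infinitePi_of_inj hσ.injective]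
  simp only [hνσ]
  rw [← map_sumElim_infinitePi ν ν, Measure.map_map hunzip hzip]
  exact Measure.map_id

theorem measurable_swapOn_prodFiltration [Preorder ι] (S : Set ι) [DecidablePred (· ∈ S)]
    (i : ι) :
    Measurable[prodFiltration Filtration.piLE Filtration.piLE i,
      prodFiltration Filtration.piLE Filtration.piLE i] (swapOn (B := B) S) := by
  have hpiecewise {g h : (ι → B) × (ι → B) → ι → B}
      (hg : Measurable[(Filtration.piLE i).prod (Filtration.piLE i), Filtration.piLE i] g)
      (hh : Measurable[(Filtration.piLE i).prod (Filtration.piLE i), Filtration.piLE i] h) :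
      Measurable[(Filtration.piLE i).prod (Filtration.piLE i), Filtration.piLE i]
        fun x => S.piecewise (g x) (h x) := by
    refine measurable_piLE_iff.2 fun j hj => ?_
    by_cases hjS : j ∈ S
    · simpa [hjS] using measurable_piLE_iff.1 hg j hj
    · simpa [hjS] using measurable_piLE_iff.1 hh j hj
  have hfst := @measurable_fst (ι → B) (ι → B) (Filtration.piLE i) (Filtration.piLE i)
  have hsnd := @measurable_snd (ι → B) (ι → B) (Filtration.piLE i) (Filtration.piLE i)
  exact (hpiecewise hsnd hfst).prodMk (hpiecewise hfst hsnd)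

theorem apply_swapOn_Iic_fst [LinearOrder ι] {A : Type*} [MeasurableSpace A]
    [MeasurableSingletonClass A] {f : (ι → B) → A} {i m : ι}
    (hf : Measurable[Filtration.piLE (X := fun _ => B) i] f) (him : i ≤ m)
    (x : (ι → B) × (ι → B)) : f (swapOn (Set.Iic m) x).1 = f x.2 := by
  refine hf.factorsThrough (funext fun j => ?_)
  exact Set.piecewise_eq_of_mem (Set.Iic m) x.2 x.1 (j.2.trans him : (j : ι) ≤ m)

theorem IsMarkovFor.comp_swapOn [Preorder ι] {ν : ι → Measure B} [∀ i, IsProbabilityMeasure (ν i)]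
    {E : ι → Type*} [∀ i, MeasurableSpace (E i)] [∀ i, MeasurableSingletonClass (E i)]
    {f : (i : ι) → (ι → B) → E i}
    (h : IsMarkovFor (Measure.infinitePi ν) Filtration.piLE f) (S : Set ι)
    [DecidablePred (· ∈ S)] :
    IsMarkovFor ((Measure.infinitePi ν).prod (Measure.infinitePi ν))
      (prodFiltration Filtration.piLE Filtration.piLE) fun i x => f i (swapOn S x).1 := by
  refine h.comp_fst.comp_measurePreserving (measurePreserving_swapOn ν S)
    (measurable_swapOn_prodFiltration S) fun i t ht => ⟨swapOn S ⁻¹' t,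
      measurable_swapOn_prodFiltration S i ht, ?_⟩
  rw [← Set.preimage_comp, (swapOn_involutive S).comp_self, Set.preimage_id]

variable [LinearOrder ι] [NoMinOrder ι] (ν : ι → Measure B) [∀ i, IsProbabilityMeasure (ν i)]

theorem eventually_measure_preimage_diff_swapOn_lt {s : Set (ι → B)} (hs : MeasurableSet s)
    {ε : ℝ≥0∞} (hε : 0 < ε) :
    ∀ᶠ m in atBot, ((Measure.infinitePi ν).prod (Measure.infinitePi ν))
      {x | x.1 ∈ s ∧ (swapOn (Set.Iic m) x).1 ∉ s} < ε := by
  obtain ⟨t, ht, hts⟩ := exists_measure_symmDiff_lt_of_generateFrom_isSetRing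
    (μ := Measure.infinitePi ν) (isSetRing_measurableCylinders (α := fun _ : ι => B))
    ⟨{Set.univ}, by simp, by
      simpa using univ_mem_measurableCylinders fun _ : ι => B, by simp⟩
    generateFrom_measurableCylinders.symm hs (ENNReal.half_pos hε.ne')
  have htm : MeasurableSet t := MeasurableSet.of_mem_measurableCylinders ht
  obtain ⟨I, T, -, rfl⟩ := (mem_measurableCylinders t).1 ht
  have hI : ∀ᶠ m in atBot, ∀ i ∈ I, m < i :=
    (Filter.eventually_all_finset I).2 fun i _ => eventually_lt_atBot i
  filter_upwards [hI] with m hm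
  set D := symmDiff (cylinder I T) s
  have hD : NullMeasurableSet D (Measure.infinitePi ν) := (htm.symmDiff hs).nullMeasurableSet
  have hcyl (x : (ι → B) × (ι → B)) :
      (swapOn (Set.Iic m) x).1 ∈ cylinder I T ↔ x.1 ∈ cylinder I T := by
    have : I.restrict (swapOn (Set.Iic m) x).1 = I.restrict x.1 := by
      funext i
      simp [swapOn, (hm i i.2).not_ge]
    simp only [mem_cylinder, this]
  have hsub : {x : (ι → B) × (ι → B) | x.1 ∈ s ∧ (swapOn (Set.Iic m) x).1 ∉ s} ⊆
      Prod.fst ⁻¹' D ∪ (Prod.fst ∘ swapOn (Set.Iic m)) ⁻¹' D := by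
    rintro x ⟨hxs, hxs'⟩
    by_cases hx : x.1 ∈ cylinder I T
    · exact Or.inr (Or.inl ⟨(hcyl x).2 hx, hxs'⟩)
    · exact Or.inl (Or.inr ⟨hxs, hx⟩)
  have hfst : MeasurePreserving Prod.fst ((Measure.infinitePi ν).prod (Measure.infinitePi ν))
      (Measure.infinitePi ν) := measurePreserving_fst
  calc ((Measure.infinitePi ν).prod (Measure.infinitePi ν)) _
      ≤ ((Measure.infinitePi ν).prod (Measure.infinitePi ν)) (Prod.fst ⁻¹' D) +
        ((Measure.infinitePi ν).prod (Measure.infinitePi ν))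
          ((Prod.fst ∘ swapOn (Set.Iic m)) ⁻¹' D) :=
        (measure_mono hsub).trans (measure_union_le _ _)
    _ = Measure.infinitePi ν D + Measure.infinitePi ν D := by
        rw [hfst.measure_preimage hD,
          (hfst.comp (measurePreserving_swapOn ν (Set.Iic m))).measure_preimage hD]
    _ < ε / 2 + ε / 2 := ENNReal.add_lt_add hts hts
    _ = ε := ENNReal.add_halves ε

theorem tendsto_measure_ne_swapOn {A : Type*} [Finite A] [MeasurableSpace A]
    [MeasurableSingletonClass A] {f : (ι → B) → A} (hf : Measurable f) :
    Tendsto (fun m => ((Measure.infinitePi ν).prod (Measure.infinitePi ν))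
      {x | f x.1 ≠ f (swapOn (Set.Iic m) x).1}) atBot (𝓝 0) := by
  cases nonempty_fintype A
  have hle (m : ι) : ((Measure.infinitePi ν).prod (Measure.infinitePi ν))
      {x | f x.1 ≠ f (swapOn (Set.Iic m) x).1} ≤
      ∑ a : A, ((Measure.infinitePi ν).prod (Measure.infinitePi ν))
        {x | x.1 ∈ f ⁻¹' {a} ∧ (swapOn (Set.Iic m) x).1 ∉ f ⁻¹' {a}} := by
    refine (measure_mono ?_).trans (measure_iUnion_fintype_le (ι := A) _ _)
    exact fun x hx => Set.mem_iUnion.2 ⟨f x.1, rfl, Ne.symm hx⟩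
  refine tendsto_of_tendsto_of_tendsto_of_le_of_le tendsto_const_nhds ?_ (fun _ => zero_le) hle
  rw [← Finset.sum_const_zero (ι := A) (s := Finset.univ)]
  exact tendsto_finsetSum _ fun a _ => tendsto_order.2 ⟨fun b hb => (not_lt_zero hb).elim,
    fun ε hε => eventually_measure_preimage_diff_swapOn_lt ν (hf (measurableSet_singleton a)) hε⟩

end Swap

/-- A process is cosy if, at each fixed time, two copies of it coupled in a non-anticipative way
whose pasts up to a remote time are independent can agree with arbitrarily high probability.
The coupling lives in `Type`, the universe of the couplings in `IsTsirelsonBrick`. -/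
def IsCosy {Ω ι : Type*} [Preorder ι] {_mΩ : MeasurableSpace Ω} (μ : Measure Ω) {E : ι → Type*}
    [∀ i, MeasurableSpace (E i)] (X : (i : ι) → Ω → E i) : Prop :=
  ∀ i, ∀ ε > 0, ∀ᶠ m in atBot, ∃ (Ω' : Type) (_ : MeasurableSpace Ω') (P : Measure Ω')
    (X' X'' : (i : ι) → Ω' → E i), IsProbabilityMeasure P ∧
      IsNonAnticipativeCoupling μ X P X' X'' ∧
      IndepFun (fun ω => Preorder.restrictLe m fun j => X' j ω)
        (fun ω => Preorder.restrictLe m fun j => X'' j ω) P ∧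
      P {ω | X' i ω ≠ X'' i ω} < ε

theorem IsStandard.isCosy {Ω : Type*} {ι : Type} [LinearOrder ι] [NoMinOrder ι]
    {mΩ : MeasurableSpace Ω} {μ : Measure Ω} [IsFiniteMeasure μ] {F : Filtration ι mΩ}
    {E : ι → Type*} [∀ i, MeasurableSpace (E i)] [∀ i, MeasurableSingletonClass (E i)]
    [∀ i, Finite (E i)] [∀ i, Nonempty (E i)] {X : (i : ι) → Ω → E i}
    (h : IsStandard μ F) (hX : IsMarkovFor μ F X) : IsCosy μ X := by
  obtain ⟨ν, hν, f, hf, hlaw⟩ := h.exists_isMarkovFor_infinitePi hX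
  let π := Measure.infinitePi ν
  have hfm : Measurable fun v i => f i v := measurable_pi_lambda _ hf.measurable
  have hlaw' {φ : (ι → ℝ) × (ι → ℝ) → ι → ℝ} (hφ : MeasurePreserving φ (π.prod π) π) :
      (π.prod π).map (fun x i => f i (φ x)) = μ.map fun ω i => X i ω :=
    (Measure.map_map hfm hφ.measurable).symm.trans ((congrArg _ hφ.map_eq).trans hlaw)
  intro i ε hε
  filter_upwards [(tendsto_order.1 (tendsto_measure_ne_swapOn ν (hf.measurable i))).2 ε hε]
    with m hm
  refine ⟨(ι → ℝ) × (ι → ℝ), inferInstance, π.prod π, fun i x => f i x.1,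
    fun i x => f i (swapOn (Set.Iic m) x).1, inferInstance,
    .of_isMarkovFor hf.comp_fst (hf.comp_swapOn _) (hlaw' measurePreserving_fst)
      (hlaw' (measurePreserving_fst.comp (measurePreserving_swapOn ν _))), ?_, hm⟩
  have hpast : (fun x : (ι → ℝ) × (ι → ℝ) =>
      Preorder.restrictLe m fun j => f j (swapOn (Set.Iic m) x).1) =
      fun x => Preorder.restrictLe m fun j => f j x.2 := by
    funext x j
    exact apply_swapOn_Iic_fst (hf.adapted j) j.2 x
  rw [hpast]
  exact indepFun_prod ((Preorder.measurable_restrictLe m).comp hfm)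
    ((Preorder.measurable_restrictLe m).comp hfm)

end Cosiness

section Bricks

variable {Ω : Type*} {mΩ : MeasurableSpace Ω} {μ : Measure Ω}

theorem indepFun_prodMk_prodMk [IsProbabilityMeasure μ] {A₁ A₂ B₁ B₂ : Type*} [MeasurableSpace A₁]
    [MeasurableSpace A₂] [MeasurableSpace B₁] [MeasurableSpace B₂] {f₁ : Ω → A₁} {f₂ : Ω → A₂}
    {g₁ : Ω → B₁} {g₂ : Ω → B₂} (hf₁ : Measurable f₁) (hf₂ : Measurable f₂)
    (hg₁ : Measurable g₁) (hg₂ : Measurable g₂) (hf : IndepFun f₁ f₂ μ) (hg : IndepFun g₁ g₂ μ)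
    (hfg : IndepFun (fun ω => (f₁ ω, f₂ ω)) (fun ω => (g₁ ω, g₂ ω)) μ) :
    IndepFun (fun ω => (f₁ ω, g₁ ω)) (fun ω => (f₂ ω, g₂ ω)) μ := by
  refine IndepSets.indep (hf₁.prodMk hg₁).comap_le (hf₂.prodMk hg₂).comap_le
    (isPiSystem_prod.comap _) (isPiSystem_prod.comap _)
    (by rw [← generateFrom_prod, MeasurableSpace.comap_generateFrom]; rfl)
    (by rw [← generateFrom_prod, MeasurableSpace.comap_generateFrom]; rfl)
    ((IndepSets_iff _ _ _).2 ?_)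
  rintro _ _ ⟨_, ⟨s₁, hs₁, t₁, ht₁, rfl⟩, rfl⟩ ⟨_, ⟨s₂, hs₂, t₂, ht₂, rfl⟩, rfl⟩
  simp only [Set.mk_preimage_prod]
  have hfst : IndepFun f₁ g₁ μ := hfg.comp measurable_fst measurable_fst
  have hsnd : IndepFun f₂ g₂ μ := hfg.comp measurable_snd measurable_snd
  calc μ (f₁ ⁻¹' s₁ ∩ g₁ ⁻¹' t₁ ∩ (f₂ ⁻¹' s₂ ∩ g₂ ⁻¹' t₂))
      = μ ((f₁ ⁻¹' s₁ ∩ f₂ ⁻¹' s₂) ∩ (g₁ ⁻¹' t₁ ∩ g₂ ⁻¹' t₂)) := by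
        rw [Set.inter_inter_inter_comm]
    _ = μ (f₁ ⁻¹' s₁ ∩ f₂ ⁻¹' s₂) * μ (g₁ ⁻¹' t₁ ∩ g₂ ⁻¹' t₂) :=
        hfg.measure_inter_preimage_eq_mul _ _ (hs₁.prod hs₂) (ht₁.prod ht₂)
    _ = (μ (f₁ ⁻¹' s₁) * μ (g₁ ⁻¹' t₁)) * (μ (f₂ ⁻¹' s₂) * μ (g₂ ⁻¹' t₂)) := by
        rw [hf.measure_inter_preimage_eq_mul _ _ hs₁ hs₂,
          hg.measure_inter_preimage_eq_mul _ _ ht₁ ht₂, mul_mul_mul_comm]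
    _ = μ (f₁ ⁻¹' s₁ ∩ g₁ ⁻¹' t₁) * μ (f₂ ⁻¹' s₂ ∩ g₂ ⁻¹' t₂) := by
        rw [hfst.measure_inter_preimage_eq_mul _ _ hs₁ ht₁,
          hsnd.measure_inter_preimage_eq_mul _ _ hs₂ ht₂]

theorem IsUniformRV.of_identDistrib {Ω' A : Type*} {_mΩ' : MeasurableSpace Ω'} {P : Measure Ω'}
    [MeasurableSpace A] {f : Ω → A} {g : Ω' → A} (hf : IsUniformRV μ f) (hg : Measurable g)
    (h : IdentDistrib g f P μ) : IsUniformRV P g :=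
  ⟨hg, h.map_eq.trans hf.2⟩

theorem IsUniformRV.measureReal_preimage_singleton {A : Type*} [Fintype A] [MeasurableSpace A]
    [MeasurableSingletonClass A] {f : Ω → A} (hf : IsUniformRV μ f) (a : A) :
    μ.real (f ⁻¹' {a}) = (Fintype.card A : ℝ)⁻¹ := by
  rw [← map_measureReal_apply hf.1 (measurableSet_singleton a), hf.2, Measure.real,
    uniformOn_univ]
  simp

theorem IsUniformRV.measureReal_ne [IsProbabilityMeasure μ] {A : Type*} [Fintype A]
    [MeasurableSpace A] [MeasurableSingletonClass A] {f g : Ω → A} (hf : IsUniformRV μ f)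
    (hg : Measurable g) (h : IndepFun f g μ) :
    μ.real {ω | f ω ≠ g ω} = 1 - (Fintype.card A : ℝ)⁻¹ := by
  have hterm (a : A) : μ.real (f ⁻¹' {a} ∩ g ⁻¹' {a}) =
      (Fintype.card A : ℝ)⁻¹ * μ.real (g ⁻¹' {a}) := by
    rw [measureReal_def, h.measure_inter_preimage_eq_mul _ _ (measurableSet_singleton a)
      (measurableSet_singleton a), ENNReal.toReal_mul]
    exact congrArg (· * _) (hf.measureReal_preimage_singleton a)
  have hsum : ∑ a, μ.real (g ⁻¹' {a}) = 1 := by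
    simpa using sum_measureReal_preimage_singleton (μ := μ) (f := g) Finset.univ
      fun a _ => hg (measurableSet_singleton a)
  have heq : {ω | f ω = g ω} = ⋃ a, f ⁻¹' {a} ∩ g ⁻¹' {a} := by
    ext ω
    simp [eq_comm]
  have hdisj : Pairwise (Function.onFun Disjoint fun a => f ⁻¹' {a} ∩ g ⁻¹' {a}) :=
    fun a b hab => ((pairwise_disjoint_fiber f hab).inter_left _).inter_right _
  have hmeas (a : A) : MeasurableSet (f ⁻¹' {a} ∩ g ⁻¹' {a}) :=
    (hf.1 (measurableSet_singleton a)).inter (hg (measurableSet_singleton a))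
  calc μ.real {ω | f ω ≠ g ω} = 1 - μ.real {ω | f ω = g ω} :=
        probReal_compl_eq_one_sub (measurableSet_eq_fun hf.1 hg)
    _ = 1 - ∑ a, (Fintype.card A : ℝ)⁻¹ * μ.real (g ⁻¹' {a}) := by
        rw [heq, measureReal_iUnion_fintype hdisj hmeas, Finset.sum_congr rfl fun a _ => hterm a]
    _ = 1 - (Fintype.card A : ℝ)⁻¹ := by rw [← Finset.mul_sum, hsum, mul_one]

theorem IsUniformRV.half_le_measureReal_ne [IsProbabilityMeasure μ] {A : Type*} [Finite A]
    [Nontrivial A] [MeasurableSpace A] [MeasurableSingletonClass A] {f g : Ω → A}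
    (hf : IsUniformRV μ f) (hg : Measurable g) (h : IndepFun f g μ) :
    1 / 2 ≤ μ.real {ω | f ω ≠ g ω} := by
  cases nonempty_fintype A
  have hcard : (2 : ℝ) ≤ Fintype.card A := by exact_mod_cast Fintype.one_lt_card
  have hinv : (Fintype.card A : ℝ)⁻¹ ≤ 2⁻¹ := inv_anti₀ two_pos hcard
  rw [hf.measureReal_ne hg h]
  linarith

theorem exists_map_eq_of_finite [IsProbabilityMeasure μ] {ι : Type} {E : ι → Type*}
    [∀ i, Finite (E i)] [∀ i, MeasurableSpace (E i)] [∀ i, MeasurableSingletonClass (E i)]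
    {X : (i : ι) → Ω → E i} (hX : ∀ i, Measurable (X i)) :
    ∃ (Ω' : Type) (_ : MeasurableSpace Ω') (P : Measure Ω') (Y : (i : ι) → Ω' → E i),
      IsProbabilityMeasure P ∧ (∀ i, Measurable (Y i)) ∧
        P.map (fun ω i => Y i ω) = μ.map fun ω i => X i ω := by
  let e (i : ι) : E i ≃ Fin (Nat.card (E i)) := Finite.equivFin (E i)
  have hcode : Measurable fun ω i => e i (X i ω) :=
    measurable_pi_lambda _ fun i => (measurable_of_finite (e i)).comp (hX i)
  have hdecode (i : ι) : Measurable fun x : (i : ι) → Fin (Nat.card (E i)) => (e i).symm (x i) :=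
    (measurable_of_finite (e i).symm).comp (measurable_pi_apply i)
  refine ⟨(i : ι) → Fin (Nat.card (E i)), inferInstance, μ.map fun ω i => e i (X i ω),
    fun i x => (e i).symm (x i), Measure.isProbabilityMeasure_map hcode.aemeasurable, hdecode, ?_⟩
  rw [Measure.map_map (measurable_pi_lambda _ hdecode) hcode]
  simp only [Function.comp_def, Equiv.symm_apply_apply]

theorem IsMarkov.exists_indepFun_coupling [IsProbabilityMeasure μ] {ι : Type} [LinearOrder ι]
    {E : ι → Type*} [∀ i, Finite (E i)] [∀ i, MeasurableSpace (E i)]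
    [∀ i, MeasurableSingletonClass (E i)] {X : (i : ι) → Ω → E i} (h : IsMarkov μ X)
    (hX : ∀ i, Measurable (X i)) :
    ∃ (Ω' : Type) (_ : MeasurableSpace Ω') (P : Measure Ω') (X' X'' : (i : ι) → Ω' → E i),
      IsProbabilityMeasure P ∧ IsNonAnticipativeCoupling μ X P X' X'' ∧
        IndepFun (fun ω i => X' i ω) (fun ω i => X'' i ω) P := by
  obtain ⟨Ω', _, P, Y, _, hY, hlaw⟩ := exists_map_eq_of_finite (μ := μ) hX
  have hYmarkov := (h.isMarkovFor hX).of_map_eq hY hlaw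
  have hYpi : Measurable fun ω i => Y i ω := measurable_pi_lambda _ hY
  have hlaw' {φ : Ω' × Ω' → Ω'} (hφ : MeasurePreserving φ (P.prod P) P) :
      (P.prod P).map (fun x i => Y i (φ x)) = μ.map fun ω i => X i ω :=
    (Measure.map_map hYpi hφ.measurable).symm.trans ((congrArg _ hφ.map_eq).trans hlaw)
  exact ⟨Ω' × Ω', inferInstance, P.prod P, fun i x => Y i x.1, fun i x => Y i x.2, inferInstance,
    .of_isMarkovFor hYmarkov.comp_fst hYmarkov.comp_snd (hlaw' measurePreserving_fst)
      (hlaw' measurePreserving_snd), indepFun_prod hYpi hYpi⟩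

namespace IsNonAnticipativeCoupling

variable {ι Ω' : Type*} [Preorder ι] {E : ι → Type*} [∀ i, MeasurableSpace (E i)]
  {X : (i : ι) → Ω → E i} {mΩ' : MeasurableSpace Ω'} {P : Measure Ω'}
  {X' X'' : (i : ι) → Ω' → E i}

theorem identDistrib_left (h : IsNonAnticipativeCoupling μ X P X' X'')
    (hX : ∀ i, Measurable (X i)) :
    IdentDistrib (fun ω i => X' i ω) (fun ω i => X i ω) P μ :=
  ⟨(measurable_pi_lambda _ h.measurable_left).aemeasurable,
    (measurable_pi_lambda _ hX).aemeasurable, h.law_left⟩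

theorem identDistrib_right (h : IsNonAnticipativeCoupling μ X P X' X'')
    (hX : ∀ i, Measurable (X i)) :
    IdentDistrib (fun ω i => X'' i ω) (fun ω i => X i ω) P μ :=
  ⟨(measurable_pi_lambda _ h.measurable_right).aemeasurable,
    (measurable_pi_lambda _ hX).aemeasurable, h.law_right⟩

end IsNonAnticipativeCoupling

namespace IsTsirelsonBrick

variable {E : Fin 3 → Type*} [∀ k, Fintype (E k)] [∀ k, MeasurableSpace (E k)]
  [∀ k, MeasurableSingletonClass (E k)] {α : ℝ} {Z : (k : Fin 3) → Ω → E k}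

section Coupling

variable {Ω' : Type} {mΩ' : MeasurableSpace Ω'} {P : Measure Ω'} [IsProbabilityMeasure P]
  {Z' Z'' : (k : Fin 3) → Ω' → E k}

theorem mul_measureReal_ne_le_inter (hZ : IsTsirelsonBrick μ α Z)
    (hc : IsNonAnticipativeCoupling μ Z P Z' Z'') :
    (1 - α) * P.real {ω | Z' 0 ω ≠ Z'' 0 ω} ≤
      P.real ({ω | Z' 0 ω ≠ Z'' 0 ω} ∩ {ω | Z' 2 ω ≠ Z'' 2 ω}) := by
  have hinit : Measurable fun ω => (Z' 0 ω, Z'' 0 ω) :=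
    (hc.measurable_left 0).prodMk (hc.measurable_right 0)
  have hne₀ : MeasurableSet[MeasurableSpace.comap (fun ω => (Z' 0 ω, Z'' 0 ω)) inferInstance]
      {ω | Z' 0 ω ≠ Z'' 0 ω} :=
    ⟨{x | x.1 ≠ x.2}, (Set.toFinite _).measurableSet, rfl⟩
  have hne₂ : MeasurableSet {ω | Z' 2 ω ≠ Z'' 2 ω} :=
    (measurableSet_eq_fun (hc.measurable_left 2) (hc.measurable_right 2)).compl
  rw [← setIntegral_condProb hinit.comap_le hne₀ hne₂, mul_comm, ← smul_eq_mul,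
    ← setIntegral_const]
  refine setIntegral_mono_ae_restrict (integrable_const _).integrableOn
    integrable_condExp.integrableOn ((ae_restrict_iff' (hinit.comap_le _ hne₀)).2 ?_)
  exact hZ.coupling Ω' mΩ' P inferInstance Z' Z'' hc

theorem measureReal_ne_le_add (hZ : IsTsirelsonBrick μ α Z)
    (hc : IsNonAnticipativeCoupling μ Z P Z' Z'') (hα : 0 ≤ α) :
    P.real {ω | Z' 0 ω ≠ Z'' 0 ω} ≤ P.real {ω | Z' 2 ω ≠ Z'' 2 ω} + α := by
  have hbrick := (hZ.mul_measureReal_ne_le_inter hc).trans (measureReal_mono Set.inter_subset_right)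
  have hle : α * P.real {ω | Z' 0 ω ≠ Z'' 0 ω} ≤ α := mul_le_of_le_one_right hα measureReal_le_one
  linarith

end Coupling

theorem inv_card_le [IsProbabilityMeasure μ] (hZ : IsTsirelsonBrick μ α Z)
    [Nontrivial (E 0)] : (Fintype.card (E 2) : ℝ)⁻¹ ≤ α := by
  have hZm (k : Fin 3) : Measurable (Z k) := (hZ.uniform k).1
  obtain ⟨Ω', _, P, Z', Z'', _, hc, hindep⟩ := hZ.markov.exists_indepFun_coupling hZm
  have heval (k : Fin 3) : Measurable fun x : (k : Fin 3) → E k => x k := measurable_pi_apply k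
  have heval₂ : Measurable fun x : (k : Fin 3) → E k => (x 0, x 2) := (heval 0).prodMk (heval 2)
  have hlaw' := hc.identDistrib_left hZm
  have hlaw'' := hc.identDistrib_right hZm
  have hne (k : Fin 3) : P.real {ω | Z' k ω ≠ Z'' k ω} = 1 - (Fintype.card (E k) : ℝ)⁻¹ :=
    ((hZ.uniform k).of_identDistrib (hc.measurable_left k)
      (hlaw'.comp (heval k))).measureReal_ne (hc.measurable_right k)
      (hindep.comp (heval k) (heval k))
  have hindep₀₂ : IndepFun (fun ω => (Z' 0 ω, Z'' 0 ω)) (fun ω => (Z' 2 ω, Z'' 2 ω)) P :=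
    indepFun_prodMk_prodMk (hc.measurable_left 0) (hc.measurable_left 2) (hc.measurable_right 0)
      (hc.measurable_right 2) (indepFun_of_identDistrib_pair hZ.indep (hlaw'.comp heval₂).symm)
      (indepFun_of_identDistrib_pair hZ.indep (hlaw''.comp heval₂).symm) (hindep.comp heval₂ heval₂)
  have hinter : P.real ({ω | Z' 0 ω ≠ Z'' 0 ω} ∩ {ω | Z' 2 ω ≠ Z'' 2 ω}) =
      P.real {ω | Z' 0 ω ≠ Z'' 0 ω} * P.real {ω | Z' 2 ω ≠ Z'' 2 ω} :=
    (congrArg ENNReal.toReal (hindep₀₂.measure_inter_preimage_eq_mul {x | x.1 ≠ x.2}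
      {x | x.1 ≠ x.2} (Set.toFinite _).measurableSet (Set.toFinite _).measurableSet)).trans
      ENNReal.toReal_mul
  have hpos : 0 < P.real {ω | Z' 0 ω ≠ Z'' 0 ω} := by
    rw [hne, sub_pos]
    exact inv_lt_one_of_one_lt₀ (by exact_mod_cast Fintype.one_lt_card)
  have hbrick := hZ.mul_measureReal_ne_le_inter hc
  rw [hinter, mul_comm, mul_le_mul_iff_right₀ hpos, hne] at hbrick
  linarith

end IsTsirelsonBrick

end Bricks

namespace NonposInt

theorem noMinOrder : NoMinOrder NonposInt :=
  ⟨fun n => ⟨⟨n.1 - 1, by have := n.2; omega⟩, Subtype.mk_lt_mk.2 (by simp)⟩⟩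

theorem brickTime_two (n : NonposInt) : n.brickTime 2 = n.double :=
  Subtype.ext (by simp [brickTime, double])

theorem exists_brickTime_zero_eq_double (n : NonposInt) :
    ∃ m : NonposInt, n.brickTime 0 = m.double :=
  ⟨⟨n.1 - 1, by have := n.2; omega⟩, Subtype.ext (by simp [brickTime, double]; ring)⟩

theorem exists_brickTime_eq (n : NonposInt) : ∃ (m : NonposInt) (k : Fin 3), m.brickTime k = n := by
  have := n.2
  rcases Int.even_or_odd' n.1 with ⟨m, hm | hm⟩
  · exact ⟨⟨m, by omega⟩, 2, Subtype.ext (by simp [brickTime, hm])⟩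
  · exact ⟨⟨m + 1, by omega⟩, 1, Subtype.ext (by simp [brickTime, hm]; ring)⟩

theorem brickTime_mono (n : NonposInt) : Monotone n.brickTime := fun k l hkl => by
  have : (k : ℕ) ≤ l := hkl
  exact Subtype.mk_le_mk.2 (by omega)

theorem brickTime_covBy (n : NonposInt) {k l : Fin 3} (h : k ⋖ l) :
    n.brickTime k ⋖ n.brickTime l := by
  have hkl : (k : ℕ) + 1 = l := Nat.covBy_iff_add_one_eq.1 (Fin.covBy_iff.1 h)
  refine ⟨Subtype.mk_lt_mk.2 (by omega), fun c hkc hcl => ?_⟩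
  have hkc' : 2 * n.1 - 2 + (k : ℕ) < c.1 := hkc
  have hcl' : c.1 < 2 * n.1 - 2 + (l : ℕ) := hcl
  omega

/-- The opposite of a natural number; it turns the times `n ≤ 0` into a sequence. -/
def neg (k : ℕ) : NonposInt := ⟨-k, by omega⟩

theorem neg_injective : Function.Injective neg := fun a b h => by
  simpa [neg] using h

theorem brickTime_neg_zero (k : ℕ) : (neg k).brickTime 0 = (neg (k + 1)).double :=
  Subtype.ext (by simp [brickTime, double, neg]; ring)

theorem tendsto_double_neg : Tendsto (fun k => (neg k).double) atTop atBot := by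
  refine tendsto_atBot.2 fun b => ?_
  filter_upwards [eventually_ge_atTop b.1.natAbs] with k hk
  refine Subtype.mk_le_mk.2 ?_
  change 2 * (-(k : ℤ)) ≤ b.1
  omega

end NonposInt

section BrickSequence

theorem exists_forall_sum_Ico_lt {a : ℕ → ℝ} (ha : Summable a) {ε : ℝ} (hε : 0 < ε) :
    ∃ K, ∀ N, ∑ k ∈ Finset.Ico K N, a k < ε := by
  obtain ⟨s, hs⟩ := ha.vanishing (Iio_mem_nhds hε)
  obtain ⟨K, hK⟩ := s.exists_nat_subset_range
  refine ⟨K, fun N => hs _ (Finset.disjoint_left.2 fun k hk hks => ?_)⟩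
  exact (Finset.mem_Ico.1 hk).1.not_gt (Finset.mem_range.1 (hK hks))

variable {Ω : Type*} {mΩ : MeasurableSpace Ω} {μ : Measure Ω} {F : NonposInt → Type*}
  [∀ n, Fintype (F n)] [∀ n, MeasurableSpace (F n)] {X : (n : NonposInt) → Ω → F n}
  {α : NonposInt → ℝ}

theorem isUniformRV_of_isTsirelsonBrick
    (hbrick : ∀ n : NonposInt, IsTsirelsonBrick μ (α n) fun k : Fin 3 => X (n.brickTime k))
    (n : NonposInt) : IsUniformRV μ (X n) := by
  obtain ⟨m, k, rfl⟩ := n.exists_brickTime_eq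
  exact (hbrick m).uniform k

variable [∀ n, MeasurableSingletonClass (F n)]

section Coupling

variable {Ω' : Type} {mΩ' : MeasurableSpace Ω'} {P : Measure Ω'} [IsProbabilityMeasure P]
  {X' X'' : (n : NonposInt) → Ω' → F n}

theorem measureReal_ne_double_neg_succ_le {G : Filtration NonposInt mΩ}
    (hX : IsMarkovFor μ G X) (hα : ∀ n, 0 ≤ α n)
    (hbrick : ∀ n : NonposInt, IsTsirelsonBrick μ (α n) fun k : Fin 3 => X (n.brickTime k))
    (hc : IsNonAnticipativeCoupling μ X P X' X'') (k : ℕ) :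
    P.real {ω | X' (.double (.neg (k + 1))) ω ≠ X'' (.double (.neg (k + 1))) ω} ≤
      P.real {ω | X' (.double (.neg k)) ω ≠ X'' (.double (.neg k)) ω} + α (.neg k) := by
  have hcoupling := hc.comp hX (NonposInt.neg k).brickTime_mono
    (NonposInt.neg k).brickTime_covBy
  have hle := (hbrick (.neg k)).measureReal_ne_le_add hcoupling (hα _)
  rwa [NonposInt.brickTime_neg_zero, NonposInt.brickTime_two] at hle

theorem measureReal_ne_double_neg_le {G : Filtration NonposInt mΩ}
    (hX : IsMarkovFor μ G X) (hα : ∀ n, 0 ≤ α n)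
    (hbrick : ∀ n : NonposInt, IsTsirelsonBrick μ (α n) fun k : Fin 3 => X (n.brickTime k))
    (hc : IsNonAnticipativeCoupling μ X P X' X'') {K N : ℕ} (hKN : K ≤ N) :
    P.real {ω | X' (.double (.neg N)) ω ≠ X'' (.double (.neg N)) ω} ≤
      P.real {ω | X' (.double (.neg K)) ω ≠ X'' (.double (.neg K)) ω} +
        ∑ k ∈ Finset.Ico K N, α (.neg k) := by
  induction N, hKN using Nat.le_induction with
  | base => simp
  | succ N hKN ih =>
    have hsucc := measureReal_ne_double_neg_succ_le hX hα hbrick hc N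
    rw [Finset.sum_Ico_succ_top hKN]
    linarith

end Coupling

variable [IsProbabilityMeasure μ] [∀ n : NonposInt, Nontrivial (F n.double)]

theorem inv_card_double_le
    (hbrick : ∀ n : NonposInt, IsTsirelsonBrick μ (α n) fun k : Fin 3 => X (n.brickTime k))
    (n : NonposInt) : (Fintype.card (F n.double) : ℝ)⁻¹ ≤ α n := by
  obtain ⟨m, hm⟩ := n.exists_brickTime_zero_eq_double
  have : Nontrivial (F (n.brickTime 0)) := hm ▸ inferInstance
  rw [← n.brickTime_two]
  exact (hbrick n).inv_card_le

theorem not_isCosy_of_isTsirelsonBrick {G : Filtration NonposInt mΩ}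
    (hX : IsMarkovFor μ G X) (hα : Summable α)
    (hbrick : ∀ n : NonposInt, IsTsirelsonBrick μ (α n) fun k : Fin 3 => X (n.brickTime k)) :
    ¬ IsCosy μ X := fun hcosy => by
  have hα₀ (n : NonposInt) : 0 ≤ α n := (by positivity : (0 : ℝ) ≤ _).trans
    (inv_card_double_le hbrick n)
  obtain ⟨K, hK⟩ := exists_forall_sum_Ico_lt (hα.comp_injective NonposInt.neg_injective)
    (ε := 1 / 4) (by norm_num)
  have hev := NonposInt.tendsto_double_neg.eventually
    (hcosy (.double (.neg K)) (ENNReal.ofReal (1 / 4)) (by simp))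
  obtain ⟨N, ⟨Ω', _, P, X', X'', _, hc, hindep, hlt⟩, hKN⟩ :=
    (hev.and (eventually_ge_atTop K)).exists
  have hXunif (n : NonposInt) : IsUniformRV μ (X n) := isUniformRV_of_isTsirelsonBrick hbrick n
  have huniform : IsUniformRV P (X' (.double (.neg N))) := (hXunif _).of_identDistrib
    (hc.measurable_left _)
    ((hc.identDistrib_left fun n => (hXunif n).1).comp (measurable_pi_apply _))
  have heval := measurable_pi_apply (X := fun n : Set.Iic (NonposInt.neg N).double => F n)
    ⟨_, Set.mem_Iic.2 le_rfl⟩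
  have hhalf := huniform.half_le_measureReal_ne (hc.measurable_right _) (hindep.comp heval heval)
  have hdrop := measureReal_ne_double_neg_le hX hα₀ hbrick hc hKN
  have hsum := hK N
  have hquarter : P.real {ω | X' (.double (.neg K)) ω ≠ X'' (.double (.neg K)) ω} < 1 / 4 :=
    (ENNReal.lt_ofReal_iff_toReal_lt (measure_ne_top _ _)).1 hlt
  simp only [Function.comp_apply] at hsum
  linarith

theorem tendsto_card_double_of_isTsirelsonBrick (hα : Summable α)
    (hbrick : ∀ n : NonposInt, IsTsirelsonBrick μ (α n) fun k : Fin 3 => X (n.brickTime k)) :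
    Tendsto (fun n : NonposInt => Fintype.card (F n.double)) atBot atTop := by
  have := NonposInt.noMinOrder
  have hα₀ : Tendsto α atBot (𝓝 0) := hα.tendsto_cofinite_zero.mono_left atBot_le_cofinite
  have hinv : Tendsto (fun n : NonposInt => (Fintype.card (F n.double) : ℝ)⁻¹) atBot (𝓝[>] 0) :=
    tendsto_nhdsWithin_iff.2
      ⟨squeeze_zero (fun n => by positivity) (inv_card_double_le hbrick) hα₀,
        .of_forall fun n => Set.mem_Ioi.2 (inv_pos.2 (Nat.cast_pos.2 Fintype.card_pos))⟩
  simpa only [Pi.inv_def, inv_inv, tendsto_natCast_atTop_iff] using hinv.inv_tendsto_nhdsGT_zero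

end BrickSequence

theorem mainTheorem6_general {Ω : Type u} {mΩ : MeasurableSpace Ω} (μ : Measure Ω)
    [IsProbabilityMeasure μ] (G : Filtration NonposInt mΩ) (F : NonposInt → Type w)
    [∀ n, Fintype (F n)] [∀ n, MeasurableSpace (F n)] [∀ n, MeasurableSingletonClass (F n)]
    (X : (n : NonposInt) → Ω → F n) (α : NonposInt → ℝ) (hα : Summable α)
    (hF : ∀ n : NonposInt, Fintype.card (F n.double) ≠ 1) (hX : IsMarkovFor μ G X)
    (hbrick : ∀ n : NonposInt, IsTsirelsonBrick μ (α n) fun k : Fin 3 => X (n.brickTime k)) :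
    ¬ IsStandard.{u, v} μ G ∧
      Tendsto (fun n : NonposInt => Fintype.card (F n.double)) atBot atTop := by
  have := NonposInt.noMinOrder
  have (n : NonposInt) : Nonempty (F n) := μ.nonempty_of_neZero.map (X n)
  have (n : NonposInt) : Nontrivial (F n.double) :=
    Fintype.one_lt_card_iff_nontrivial.1 (Nat.lt_of_le_of_ne Fintype.card_pos (hF n).symm)
  exact ⟨fun h => not_isCosy_of_isTsirelsonBrick hX hα hbrick (h.isCosy hX),
    tendsto_card_double_of_isTsirelsonBrick hα hbrick⟩

theorem mainTheorem6 {Ω : Type u} {mΩ : MeasurableSpace Ω} (μ : Measure Ω)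
    [IsProbabilityMeasure μ] (F : NonposInt → Type w) [∀ n, Fintype (F n)]
    [∀ n, MeasurableSpace (F n)] [∀ n, MeasurableSingletonClass (F n)]
    (X : (n : NonposInt) → Ω → F n) (hX : ∀ n, IsUniformRV μ (X n))
    (α : NonposInt → ℝ) (hα : ∀ n, α n ∈ Set.Ioo (0 : ℝ) 1) (hαsum : Summable α)
    (hF : ∀ n : NonposInt, Fintype.card (F n.double) ≠ 1)
    (hMarkov : IsMarkov μ X)
    (hbrick : ∀ n : NonposInt, IsTsirelsonBrick μ (α n) fun k : Fin 3 => X (n.brickTime k)) :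
    ¬ IsStandard.{u, v} μ (naturalFiltration μ X) ∧
      (IsTrivialSigma μ (⨅ n, naturalFiltration μ X n) →
        Tendsto (fun n : NonposInt => Fintype.card (F n.double)) atBot atTop) :=
  (mainTheorem6_general μ _ F X α hαsum hF (hMarkov.isMarkovFor fun n => (hX n).1)
    hbrick).imp_right fun h _ => h
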